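/- Let $a>0$ and $0<\alpha<\frac{\pi}{2a}$. In $L^2(-a,a)$, with inner product antilinear in the first argument, let $H\psi=-\psi''$ with $$\operatorname{Dom}(H)=\{\psi\in W^{2,2}(-a,a):\ \psi'(\pm a)+i\alpha\,\psi(\pm a)=0\},$$ and let $(\mathcal P\psi)(x)=\psi(-x)$. Put $k_n=\frac{n\pi}{2a}$ and $$\phi_0(x)=\tfrac{1}{\sqrt{2a}}\,e^{i\alpha(x+a)},\qquad \phi_n(x)=\tfrac1{\sqrt a}\Big(\cos k_n(x+a)+i\tfrac{\alpha}{k_n}\sin k_n(x+a)\Big)\quad(n\ge1).$$ A bounded operator $S$ with bounded inverse makes $H$ *$S$-self-adjoint* if $H=S^{-1}H^*S$. A *metric operator* for $H$ is a bounded operator $\Theta$ with bounded inverse such that $\langle f,\Theta f\rangle>0$ for all $f\ne0$ and $H$ is $\Theta$-self-adjoint. When $H$ is $\mathcal P$-self-adjoint, a *$\mathcal C$ operator* for $H$ is a bounded operator $\mathcal C$ with $\mathcal CH\subset H\mathcal C$, $\mathcal C^2=I$ and $\mathcal P\mathcal C$ a metric operator for $H$. A sequence $(C_n)_{n\ge0}$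 of real numbers is *admissible* if $0<m_1<C_n<m_2<\infty$ for all $n$, for some constants $m_1,m_2$. Then $H$ is densely defined and the $\phi_n$ are eigenfunctions of the adjoint: $\phi_n\neq0$, $H^*\phi_0=\alpha^2\phi_0$ and $H^*\phi_n=k_n^2\phi_n$ for $n\ge1$. For every admissible $(C_n)$ the series $$\Theta=\sum_{n=0}^\infty C_n^2\,\phi_n\langle\phi_n,\cdot\rangle$$ converges strongly to a bounded operator, and $(\mathcal P\Theta)^2=I$ if and only if $$C_0^2=\frac{2|\alpha|a}{|\sin(2\alpha a)|},\qquad C_n^2=\frac{k_n^2}{|k_n^2-\alpha^2|}\quad(n\ge1).$$ An admissible sequence with these squares exists. For it, $\Theta$ is a metric operator for $H$ and $\Theta=I+K$, where $K$ is the integral operator on $L^2(-a,a)$ with the square-integrable kernel $$\mathcal K(x,y)=\alpha\,e^{-i\alpha(y-x)}\big[\tan(\alpha a)-i\,\operatorname{sgn}(y-x)\big];$$ moreover $H$ is $\mathcal P$-self-adjoint, $\mathcal C:=\mathcal P\Theta$ is a $\mathcal C$ operator for $H$, and $\mathcal C=\mathcal P+L$, where $L$ is the integral operator with the square-integrable kernel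 $$\mathcal L(x,y)=\alpha\,e^{-i\alpha(y+x)}\big[\tan(\alpha a)-i\,\operatorname{sgn}(y+x)\big].$$ -/

import Mathlib

open MeasureTheory

noncomputable section

namespace RobinPT

/-! ### Metric operators and `𝒞` operators for an unbounded operator on a Hilbert space -/

section Abstract

variable {E : Type*} [NormedAddCommGroup E] [InnerProductSpace ℂ E] [CompleteSpace E]

/-- `H` is `S`-self-adjoint: `S` is bounded with bounded inverse and `H = S⁻¹ H* S` as unbounded
operators (equality of domains included).  Indeed `(ψ, f)` lies in the graph of `S⁻¹ H* S` iff
`S ψ ∈ Dom H*` and `S f = H* (S ψ)`. -/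
def IsSelfAdjointWrt (H : E →ₗ.[ℂ] E) (S : E →L[ℂ] E) : Prop :=
  IsUnit S ∧ ∀ ψ f : E, (ψ, f) ∈ H.graph ↔ (S ψ, S f) ∈ H.adjoint.graph

/-- A metric operator for `H`: a bounded positive operator `Θ` with bounded inverse such that
`H` is `Θ`-self-adjoint. -/
def IsMetricOperator (H : E →ₗ.[ℂ] E) (Θ : E →L[ℂ] E) : Prop :=
  (∀ f : E, f ≠ 0 → (inner ℂ f (Θ f)).im = 0 ∧ 0 < (inner ℂ f (Θ f)).re) ∧
    IsSelfAdjointWrt H Θ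

/-- The bounded operator `C` commutes with the unbounded operator `H`, i.e. `C H ⊆ H C`. -/
def Commutes (H : E →ₗ.[ℂ] E) (C : E →L[ℂ] E) : Prop :=
  ∀ ψ f : E, (ψ, f) ∈ H.graph → (C ψ, C f) ∈ H.graph

/-- `C` is a `𝒞` operator for the `P`-self-adjoint operator `H`:
`[H, C] = 0`, `C² = I` and `P C` is a metric operator for `H`. -/
def IsCOperator (P : E →L[ℂ] E) (H : E →ₗ.[ℂ] E) (C : E →L[ℂ] E) : Prop :=
  IsSelfAdjointWrt H P ∧ Commutes H C ∧ C * C = 1 ∧ IsMetricOperator H (P * C)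

end Abstract

/-! ### The Hilbert space `L²(-a,a)`, the parity and integral operators -/

/-- Lebesgue measure on `(-a,a)`. -/
abbrev vol (a : ℝ) : Measure ℝ := volume.restrict (Set.Ioo (-a) a)

/-- The Hilbert space `L²(-a,a)` of complex functions. -/
abbrev L2 (a : ℝ) : Type := Lp ℂ 2 (vol a)

theorem measurePreserving_neg_vol (a : ℝ) :
    MeasurePreserving (fun x : ℝ => -x) (vol a) (vol a) := by
  have h := (Measure.measurePreserving_neg (volume : Measure ℝ)).restrict_preimage
    (s := Set.Ioo (-a) a) measurableSet_Ioo
  have hs : (Neg.neg : ℝ → ℝ) ⁻¹' Set.Ioo (-a) a = Set.Ioo (-a) a := by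
    ext x
    simp only [Set.mem_preimage, Set.mem_Ioo]
    constructor <;> rintro ⟨h1, h2⟩ <;> constructor <;> linarith
  rw [hs] at h
  exact h

/-- The parity `(P ψ)(x) = ψ(-x)` on `L²(-a,a)`. -/
def parity (a : ℝ) : L2 a →L[ℂ] L2 a :=
  (Lp.compMeasurePreservingₗᵢ ℂ (fun x : ℝ => -x)
    (measurePreserving_neg_vol a)).toContinuousLinearMap

/-- `T` is the (Hilbert-Schmidt) integral operator on `L²(-a,a)` with the kernel `k`. -/
def IsIntegralOperator (a : ℝ) (k : ℝ → ℝ → ℂ) (T : L2 a →L[ℂ] L2 a) : Prop :=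
  MemLp (Function.uncurry k) 2 ((vol a).prod (vol a)) ∧
    ∀ f : L2 a, ∀ᵐ x ∂(vol a), T f x = ∫ y, k x y * f y ∂(vol a)

/-! ### The operator `H` -/

/-- On `[-a,a]` the function `u` is absolutely continuous with derivative `g ∈ L¹(-a,a)`, i.e. `u`
is an indefinite integral of `g`.  If `g ∈ L²(-a,a)`, such `u` are precisely the continuous
representatives of the elements of `W^{1,2}(-a,a)` with weak derivative `g`. -/
def IsPrimitive (a : ℝ) (u g : ℝ → ℂ) : Prop :=
  Integrable g (vol a) ∧ ∀ x ∈ Set.Icc (-a) a, u x = u (-a) + ∫ t in (-a)..x, g t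

theorem IsPrimitive.intervalIntegrable {a x : ℝ} {u g : ℝ → ℂ} (h : IsPrimitive a u g)
    (hx : x ∈ Set.Icc (-a) a) : IntervalIntegrable g volume (-a) x := by
  rw [intervalIntegrable_iff_integrableOn_Ioo_of_le hx.1]
  exact IntegrableOn.mono_set h.1 (Set.Ioo_subset_Ioo_right hx.2)

theorem IsPrimitive.continuousOn {a : ℝ} {u g : ℝ → ℂ} (h : IsPrimitive a u g) :
    ContinuousOn u (Set.Icc (-a) a) := by
  rcases le_or_gt (-a) a with ha | ha
  · have h1 : ContinuousOn (fun x => ∫ t in (-a)..x, g t) (Set.Icc (-a) a) := by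
      have := intervalIntegral.continuousOn_primitive_interval (f := g) (a := -a) (b := a)
        (μ := volume) (by
          rw [Set.uIcc_of_le ha, integrableOn_Icc_iff_integrableOn_Ioo]
          exact h.1)
      rwa [Set.uIcc_of_le ha] at this
    exact (continuousOn_const.add h1).congr h.2
  · rw [Set.Icc_eq_empty (not_le.2 ha)]
    exact continuousOn_empty _

theorem IsPrimitive.add {a : ℝ} {u g u' g' : ℝ → ℂ} (h : IsPrimitive a u g)
    (h' : IsPrimitive a u' g') :
    IsPrimitive a (fun x => u x + u' x) (fun x => g x + g' x) := by
  refine ⟨h.1.add h'.1, fun x hx => ?_⟩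
  rw [intervalIntegral.integral_add (h.intervalIntegrable hx) (h'.intervalIntegrable hx)]
  beta_reduce
  rw [h.2 x hx, h'.2 x hx]
  ring

theorem IsPrimitive.const_mul {a : ℝ} {u g : ℝ → ℂ} (c : ℂ) (h : IsPrimitive a u g) :
    IsPrimitive a (fun x => c * u x) (fun x => c * g x) := by
  refine ⟨h.1.const_mul c, fun x hx => ?_⟩
  rw [intervalIntegral.integral_const_mul]
  beta_reduce
  rw [h.2 x hx]
  ring

theorem IsPrimitive.congr {a : ℝ} {u g g' : ℝ → ℂ} (h : IsPrimitive a u g)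
    (hg : g =ᵐ[vol a] g') : IsPrimitive a u g' := by
  refine ⟨h.1.congr hg, fun x hx => ?_⟩
  rw [h.2 x hx]
  congr 1
  refine intervalIntegral.integral_congr_ae_restrict ?_
  rw [Set.uIoc_of_le hx.1, ← restrict_Ioo_eq_restrict_Ioc]
  exact ae_restrict_of_ae_restrict_of_subset (Set.Ioo_subset_Ioo_right hx.2) hg

/-- The graph of `H`: the pairs `(ψ, -ψ'')` with `ψ ∈ W^{2,2}(-a,a)` and
`ψ'(±a) + c_± ψ(±a) = 0`.  Here `u`, `v` are the continuous representatives of `ψ`, `ψ'`. -/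
def robinGraph (a : ℝ) (cminus cplus : ℂ) : Submodule ℂ (L2 a × L2 a) where
  carrier := {p | ∃ u v : ℝ → ℂ, p.1 =ᵐ[vol a] u ∧ IsPrimitive a u v ∧
    IsPrimitive a v (fun x => -(p.2 x)) ∧
    v a + cplus * u a = 0 ∧ v (-a) + cminus * u (-a) = 0}
  zero_mem' := by
    have h0 : (⇑(0 : L2 a) : ℝ → ℂ) =ᵐ[vol a] fun _ => 0 := Lp.coeFn_zero ℂ 2 (vol a)
    have hp : IsPrimitive a (fun _ => (0 : ℂ)) (fun _ => 0) :=
      ⟨integrable_zero _ _ _, fun x _ => by simp⟩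
    refine ⟨fun _ => 0, fun _ => 0, h0, hp, hp.congr ?_, by simp, by simp⟩
    filter_upwards [h0] with x hx
    change (0 : ℂ) = -((0 : L2 a) x)
    rw [hx, neg_zero]
  add_mem' := by
    rintro ⟨ψ, f⟩ ⟨ψ', f'⟩ ⟨u, v, h1, h2, h3, h4, h5⟩ ⟨u', v', h1', h2', h3', h4', h5'⟩
    refine ⟨_, _, ?_, h2.add h2', (h3.add h3').congr ?_, ?_, ?_⟩
    · filter_upwards [h1, h1', Lp.coeFn_add ψ ψ'] with x e e' e''
      simp_all
    · filter_upwards [Lp.coeFn_add f f'] with x e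
      simp only [Prod.mk_add_mk, e, Pi.add_apply]
      ring
    · linear_combination h4 + h4'
    · linear_combination h5 + h5'
  smul_mem' := by
    rintro c ⟨ψ, f⟩ ⟨u, v, h1, h2, h3, h4, h5⟩
    refine ⟨_, _, ?_, h2.const_mul c, (h3.const_mul c).congr ?_, ?_, ?_⟩
    · filter_upwards [h1, Lp.coeFn_smul c ψ] with x e e'
      simp_all
    · filter_upwards [Lp.coeFn_smul c f] with x e
      simp [e]
    · linear_combination c * h4
    · linear_combination c * h5

/-- The operator `H ψ = -ψ''` in `L²(-a,a)` with
`Dom H = {ψ ∈ W^{2,2}(-a,a) : ψ'(±a) + c_± ψ(±a) = 0}`. -/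
def robin (a : ℝ) (cminus cplus : ℂ) : L2 a →ₗ.[ℂ] L2 a :=
  (robinGraph a cminus cplus).toLinearPMap

theorem IsPrimitive.ae_eq_zero {a : ℝ} {u g : ℝ → ℂ} (h : IsPrimitive a u g)
    (hu : ∀ x ∈ Set.Icc (-a) a, u x = 0) : g =ᵐ[vol a] fun _ => 0 := by
  rcases le_or_gt (-a) a with ha | ha
  · have hint := h.intervalIntegrable (Set.right_mem_Icc.2 ha)
    have hd := hint.ae_hasDerivAt_integral
    refine (ae_restrict_iff' measurableSet_Ioo).2 ?_
    filter_upwards [hd] with x hx hxI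
    have hxu : x ∈ Set.uIcc (-a) a := by
      rw [Set.uIcc_of_le ha]; exact Set.Ioo_subset_Icc_self hxI
    have h1 := hx hxu (-a) Set.left_mem_uIcc
    have h2 : HasDerivAt (fun y => ∫ t in (-a)..y, g t) 0 x := by
      refine (hasDerivAt_const x (0 : ℂ)).congr_of_eventuallyEq ?_
      filter_upwards [isOpen_Ioo.mem_nhds hxI] with y hy
      have hyI := Set.Ioo_subset_Icc_self hy
      have := h.2 y hyI
      rw [hu y hyI, hu (-a) (Set.left_mem_Icc.2 ha), zero_add] at this
      exact this.symm
    exact h1.unique h2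
  · refine (ae_restrict_iff' measurableSet_Ioo).2 (Filter.Eventually.of_forall fun x hx => ?_)
    exact absurd (hx.1.trans hx.2) (by linarith)

/-- `robinGraph` is single-valued, hence it is the graph of `robin`. -/
theorem robin_graph (a : ℝ) (cminus cplus : ℂ) :
    (robin a cminus cplus).graph = robinGraph a cminus cplus := by
  refine Submodule.toLinearPMap_graph_eq _ ?_
  rintro ⟨ψ, f⟩ ⟨u, v, h1, h2, h3, -, -⟩ (rfl : ψ = 0)
  have zero_of_ae : ∀ w : ℝ → ℂ, w =ᵐ[vol a] (fun _ => 0) → ContinuousOn w (Set.Icc (-a) a) →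
      0 < a → ∀ x ∈ Set.Icc (-a) a, w x = 0 := by
    intro w hw hc ha
    refine Measure.eqOn_Icc_of_ae_eq (μ := volume) (by linarith) ?_ hc continuousOn_const
    rwa [← restrict_Ioo_eq_restrict_Icc]
  have hf : f =ᵐ[vol a] fun _ => 0 := by
    rcases lt_or_ge 0 a with ha | ha
    · have hu : u =ᵐ[vol a] fun _ => 0 := h1.symm.trans (Lp.coeFn_zero ℂ 2 (vol a))
      have hv := h2.ae_eq_zero (zero_of_ae u hu h2.continuousOn ha)
      have hf := h3.ae_eq_zero (zero_of_ae v hv h3.continuousOn ha)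
      filter_upwards [hf] with x hx
      simpa using hx
    · refine (ae_restrict_iff' measurableSet_Ioo).2 (Filter.Eventually.of_forall fun x hx => ?_)
      exact absurd (hx.1.trans hx.2) (by linarith)
  exact Lp.ext (hf.trans (Lp.coeFn_zero ℂ 2 (vol a)).symm)

/-! ### The eigenfunctions of `H*` for `c_± = iα`, and the operators `Θ` -/

/-- `k_n = nπ/(2a)`. -/
def kn (a : ℝ) (n : ℕ) : ℝ := n * Real.pi / (2 * a)

/-- The Neumann eigenfunctions `χ_n^N`. -/
def chiN (a : ℝ) (n : ℕ) (x : ℝ) : ℝ :=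
  if n = 0 then 1 / √(2 * a) else 1 / √a * Real.cos (kn a n * (x + a))

/-- The Dirichlet eigenfunctions `χ_n^D` (with `χ_0^D = 0`). -/
def chiD (a : ℝ) (n : ℕ) (x : ℝ) : ℝ := 1 / √a * Real.sin (kn a n * (x + a))

/-- `φ_0(x) = e^{iα(x+a)}/√(2a)` and `φ_n = χ_n^N + i (α/k_n) χ_n^D` for `n ≥ 1`. -/
def phiFun (a α : ℝ) (n : ℕ) (x : ℝ) : ℂ :=
  if n = 0 then 1 / (√(2 * a) : ℝ) * Complex.exp (Complex.I * α * (x + a))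
  else chiN a n x + Complex.I * (α / kn a n : ℝ) * chiD a n x

theorem continuous_phiFun (a α : ℝ) (n : ℕ) : Continuous (phiFun a α n) := by
  by_cases hn : n = 0
  · have h : phiFun a α n = fun x : ℝ =>
        1 / (√(2 * a) : ℝ) * Complex.exp (Complex.I * α * (x + a)) := by
      funext x; simp [phiFun, hn]
    rw [h]
    fun_prop
  · have h : phiFun a α n = fun x : ℝ => ((1 / √a * Real.cos (kn a n * (x + a)) : ℝ) : ℂ) +
        Complex.I * (α / kn a n : ℝ) * ((1 / √a * Real.sin (kn a n * (x + a)) : ℝ) : ℂ) := by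
      funext x; simp only [phiFun, chiN, chiD, if_neg hn]
    rw [h]
    fun_prop

theorem memLp_phiFun (a α : ℝ) (n : ℕ) : MemLp (phiFun a α n) 2 (vol a) := by
  have hc := continuous_phiFun a α n
  obtain ⟨B, hB⟩ := (isCompact_Icc (a := -a) (b := a)).exists_bound_of_continuousOn hc.continuousOn
  refine MemLp.of_bound hc.aestronglyMeasurable B ?_
  exact (ae_restrict_iff' measurableSet_Ioo).2
    (Filter.Eventually.of_forall fun x hx => hB x (Set.Ioo_subset_Icc_self hx))

/-- The eigenfunctions `φ_n` of `H*` as elements of `L²(-a,a)`. -/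
def phi (a α : ℝ) (n : ℕ) : L2 a := (memLp_phiFun a α n).toLp

/-- The eigenvalues of `H` and `H*`: `λ_0 = α²` and `λ_n = k_n²` for `n ≥ 1`. -/
def eigenvalue (a α : ℝ) (n : ℕ) : ℝ := if n = 0 then α ^ 2 else kn a n ^ 2

/-- The coefficients are positive, bounded, and bounded away from `0`. -/
def IsAdmissible (C : ℕ → ℝ) : Prop :=
  ∃ m₁ m₂ : ℝ, 0 < m₁ ∧ ∀ n, m₁ < C n ∧ C n < m₂

/-- `Θ = ∑ₙ C_n² φ_n ⟨φ_n, ·⟩` in the strong sense. -/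
def IsTheta (a α : ℝ) (C : ℕ → ℝ) (Θ : L2 a →L[ℂ] L2 a) : Prop :=
  ∀ f : L2 a, Filter.Tendsto
    (fun N : ℕ => ∑ n ∈ Finset.range N,
      (((C n ^ 2 : ℝ) : ℂ) * inner ℂ (phi a α n) f) • phi a α n)
    Filter.atTop (nhds (Θ f))

/-- The squares `C_0² = 2|α|a/|sin(2αa)|` and `C_n² = k_n²/|k_n²-α²|` for `n ≥ 1`. -/
def choiceSq (a α : ℝ) (n : ℕ) : ℝ :=
  if n = 0 then 2 * |α| * a / |Real.sin (2 * α * a)|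
  else kn a n ^ 2 / |kn a n ^ 2 - α ^ 2|

/-- The kernel `α e^{-iα(y-x)} [tan(αa) - i sgn(y-x)]`. -/
def kernelK (a α : ℝ) (x y : ℝ) : ℂ :=
  α * Complex.exp (-Complex.I * α * (y - x)) *
    ((Real.tan (α * a) : ℝ) - Complex.I * (Real.sign (y - x) : ℝ))

/-- The kernel `α e^{-iα(y+x)} [tan(αa) - i sgn(y+x)]`. -/
def kernelL (a α : ℝ) (x y : ℝ) : ℂ :=
  α * Complex.exp (-Complex.I * α * (y + x)) *
    ((Real.tan (α * a) : ℝ) - Complex.I * (Real.sign (y + x) : ℝ))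

end RobinPT

end

open RobinPT

noncomputable section

namespace RobinPT

/-! ### Calculus of primitives -/

section Primitive

variable {a : ℝ} {u g w k : ℝ → ℂ}

/-! The functions `φ_n` are eigenfunctions of the operator with boundary constants `-iα`, and the
reflections `P φ_n` are eigenfunctions of `H`, with the same eigenvalues. That the operator with
constants `-iα` is `H*` follows from Green's formula (`inner_robinGraph`) and from surjectivity of
both operators (`exists_mem_robinGraph`). Since `0 < α < k_1 < k_2 < ...`, the eigenvalues are
distinct, so `⟨φ_m, P φ_n⟩ = 0` for `m ≠ n`. The diagonal values `s_n = ⟨φ_n, P φ_n⟩` (`overlap`)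
are computed explicitly; they are nonzero with sign `(-1)^n`.

Biorthogonality collapses the series on reflected eigenfunctions: `Θ P φ_n = C_n² s_n φ_n`. So `(P
Θ)²` multiplies `P φ_n` by `(C_n² s_n)²`, and as the `P φ_n` span a dense subspace, `(P Θ)² = I`
means exactly `C_n² = 1/|s_n|` for all `n`. Then `Θ P φ_n = (-1)^n φ_n`, and an explicit integration
shows that `I + K` acts in the same way, so `Θ = I + K`. Multiplication by `P` gives the formula for
`C`.

Completeness (`eq_zero_of_inner_phi`) comes from completeness of the cosines: integration by parts
turns orthogonality to the `φ_n`, `n ≥ 1`, into a first-order equation whose solutions are multiples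
of `P φ_0`, and `s_0 ≠ 0` removes these. The series converges because `φ_n` for `n ≥ 1` is a
combination, with bounded coefficients, of two orthonormal families. `Θ` maps the graph of `H` into
that of `H*` because its partial sums do and `H*` is closed; the relation `(P Θ)² = I` supplies both
the inverse of `Θ` and the converse inclusion. -/

theorem integral_vol (ha : 0 < a) (f : ℝ → ℂ) : ∫ x, f x ∂(vol a) = ∫ x in (-a)..a, f x := by
  rw [intervalIntegral.integral_of_le (by linarith), ← restrict_Ioo_eq_restrict_Ioc]

theorem integrable_vol_iff (ha : 0 < a) :
    Integrable g (vol a) ↔ IntervalIntegrable g volume (-a) a := by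
  rw [intervalIntegrable_iff_integrableOn_Ioo_of_le (by linarith)]
  rfl

theorem ContinuousOn.integrable_vol (hg : ContinuousOn g (Set.Icc (-a) a)) :
    Integrable g (vol a) :=
  (hg.integrableOn_Icc).mono_set Set.Ioo_subset_Icc_self

theorem ContinuousOn.memLp_vol (hg : ContinuousOn g (Set.Icc (-a) a)) : MemLp g 2 (vol a) := by
  obtain ⟨B, hB⟩ := (isCompact_Icc (a := -a) (b := a)).exists_bound_of_continuousOn hg
  refine MemLp.of_bound ((hg.mono Set.Ioo_subset_Icc_self).aestronglyMeasurable
    measurableSet_Ioo) B ?_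
  exact (ae_restrict_iff' measurableSet_Ioo).2
    (Filter.Eventually.of_forall fun x hx => hB x (Set.Ioo_subset_Icc_self hx))

/-- The fundamental theorem of calculus. -/
theorem IsPrimitive.integral_eq (ha : 0 < a) (h : IsPrimitive a u g) :
    ∫ x, g x ∂(vol a) = u a - u (-a) := by
  rw [integral_vol ha, h.2 a ⟨by linarith, le_rfl⟩]
  ring

theorem IsPrimitive.of_hasDerivAt (hd : ∀ x, HasDerivAt u (g x) x) (hg : Continuous g) :
    IsPrimitive a u g := by
  refine ⟨ContinuousOn.integrable_vol hg.continuousOn, fun x _ => ?_⟩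
  rw [intervalIntegral.integral_eq_sub_of_hasDerivAt (fun y _ => hd y)
    (hg.intervalIntegrable _ _)]
  ring

theorem _root_.AbsolutelyContinuousOnInterval.congr {f f' : ℝ → ℂ} {b c : ℝ}
    (h : AbsolutelyContinuousOnInterval f b c) (he : Set.EqOn f f' (Set.uIcc b c)) :
    AbsolutelyContinuousOnInterval f' b c := by
  rw [absolutelyContinuousOnInterval_iff] at h ⊢
  intro ε hε
  obtain ⟨δ, hδ, hE⟩ := h ε hε
  refine ⟨δ, hδ, fun E hE1 hE2 => ?_⟩
  refine (Finset.sum_congr rfl fun i hi => ?_).trans_lt (hE E hE1 hE2)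
  rw [he (hE1.1 i hi).1, he (hE1.1 i hi).2]

theorem IsPrimitive.absolutelyContinuousOnInterval_primitive (ha : 0 < a)
    (h : Integrable g (vol a)) (c : ℂ) :
    AbsolutelyContinuousOnInterval (fun x => c + ∫ t in (-a)..x, g t) (-a) a := by
  have hi := (integrable_vol_iff ha).1 h
  have hre : IntervalIntegrable (fun x => (g x).re) volume (-a) a := ⟨hi.1.re, hi.2.re⟩
  have him : IntervalIntegrable (fun x => (g x).im) volume (-a) a := ⟨hi.1.im, hi.2.im⟩
  have hconst : ∀ z : ℂ, AbsolutelyContinuousOnInterval (fun _ : ℝ => z) (-a) a := fun z =>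
    ((LipschitzWith.const z).lipschitzOnWith (s := Set.uIcc (-a) a)).absolutelyContinuousOnInterval
  have h1 := hre.absolutelyContinuousOnInterval_intervalIntegral (c := -a) (by simp)
  have h2 := him.absolutelyContinuousOnInterval_intervalIntegral (c := -a) (by simp)
  -- The primitive is reassembled as `c + (∫ Re g)·1 + (∫ Im g)·i`, each summand being absolutely
  -- continuous.
  refine ((hconst c).fun_add ((h1.fun_smul (hconst 1)).fun_add
    (h2.fun_smul (hconst Complex.I)))).congr fun x hx => ?_
  have hx' := hi.mono_set (Set.uIcc_subset_uIcc_left hx)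
  have e1 := Complex.reCLM.intervalIntegral_comp_comm hx'
  have e2 := Complex.imCLM.intervalIntegral_comp_comm hx'
  simp only [Complex.reCLM_apply, Complex.imCLM_apply] at e1 e2
  simp only [e1, e2]
  apply Complex.ext <;> simp

/-- The product rule for absolutely continuous functions. -/
theorem IsPrimitive.mul (ha : 0 < a) (h : IsPrimitive a u g) (h' : IsPrimitive a w k) :
    IsPrimitive a (fun x => u x * w x) (fun x => g x * w x + u x * k x) := by
  have hle : -a ≤ a := by linarith
  have i1 : Integrable (fun x => g x * w x) (vol a) :=
    IntegrableOn.mul_continuousOn_of_subset h.1 h'.continuousOn measurableSet_Ioo isCompact_Icc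
      Set.Ioo_subset_Icc_self
  have i2 : Integrable (fun x => u x * k x) (vol a) :=
    IntegrableOn.continuousOn_mul_of_subset h.continuousOn h'.1 isCompact_Icc measurableSet_Ioo
      Set.Ioo_subset_Icc_self
  have i3 := i1.add i2
  refine ⟨i3, ?_⟩
  -- `u` and `w` are controlled only on `[-a,a]`, so they are replaced by their integral formulas.
  -- The product minus the primitive of its expected derivative is absolutely continuous with
  -- derivative zero almost everywhere, hence constant.
  have acu := absolutelyContinuousOnInterval_primitive ha h.1 (u (-a))
  have acw := absolutelyContinuousOnInterval_primitive ha h'.1 (w (-a))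
  have acp := absolutelyContinuousOnInterval_primitive ha i3 0
  have ac := (acu.fun_smul acw).fun_sub acp
  obtain ⟨C, hC⟩ := ac.const_of_ae_hasDerivAt_zero (by
    filter_upwards [((integrable_vol_iff ha).1 h.1).ae_hasDerivAt_integral,
      ((integrable_vol_iff ha).1 h'.1).ae_hasDerivAt_integral,
      ((integrable_vol_iff ha).1 i3).ae_hasDerivAt_integral] with x h1 h2 h3 hx
    have d1 := (h1 hx (-a) (by simp)).const_add (u (-a))
    have d2 := (h2 hx (-a) (by simp)).const_add (w (-a))
    have d3 := (h3 hx (-a) (by simp)).const_add 0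
    rw [Set.uIcc_of_le hle] at hx
    have d := (d1.mul d2).sub d3
    convert! d using 1
    simp only [Pi.add_apply]
    rw [← h.2 x hx, ← h'.2 x hx]
    ring)
  intro x hx
  rw [Set.uIcc_of_le hle] at hC
  have e1 := hC x hx
  have e2 := hC (-a) ⟨le_rfl, hle⟩
  rw [← e2] at e1
  simp only [smul_eq_mul, ← h.2 x hx, ← h'.2 x hx, intervalIntegral.integral_same, zero_add,
    add_zero, sub_zero, Pi.add_apply] at e1
  rw [sub_eq_iff_eq_add] at e1
  exact e1

theorem IsPrimitive.intervalIntegral (hg : Integrable g (vol a)) (c : ℂ) :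
    IsPrimitive a (fun x => c + ∫ t in (-a)..x, g t) g :=
  ⟨hg, fun x _ => by simp⟩

theorem IsPrimitive.conj (h : IsPrimitive a u g) :
    IsPrimitive a (fun x => (starRingEnd ℂ) (u x)) (fun x => (starRingEnd ℂ) (g x)) := by
  refine ⟨(Complex.conjCLE.toContinuousLinearMap.integrable_comp h.1), fun x hx => ?_⟩
  beta_reduce
  rw [h.2 x hx, map_add, intervalIntegral.intervalIntegral_eq_integral_uIoc,
    intervalIntegral.intervalIntegral_eq_integral_uIoc, integral_conj]
  simp [hx.1]

theorem IsPrimitive.comp_neg (ha : 0 < a) (h : IsPrimitive a u g) :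
    IsPrimitive a (fun x => u (-x)) (fun x => -g (-x)) := by
  refine ⟨((measurePreserving_neg_vol a).integrable_comp_of_integrable h.1).neg, fun x hx => ?_⟩
  have hx' : -x ∈ Set.Icc (-a) a := ⟨by linarith [hx.2], by linarith [hx.1]⟩
  have haa : a ∈ Set.Icc (-a) a := ⟨by linarith, le_rfl⟩
  rw [intervalIntegral.integral_neg, intervalIntegral.integral_comp_neg (fun t => g t)]
  beta_reduce
  rw [neg_neg, h.2 _ hx', h.2 _ haa,
    ← intervalIntegral.integral_add_adjacent_intervals (h.intervalIntegrable hx')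
      ((h.intervalIntegrable hx').symm.trans (h.intervalIntegrable haa))]
  ring

end Primitive

/-! ### The Hilbert space -/

theorem L2.integrable {a : ℝ} (f : L2 a) : Integrable f (vol a) :=
  (Lp.memLp f).integrable (by norm_num)

theorem inner_eq_integral {a : ℝ} {f g : L2 a} {u v : ℝ → ℂ} (hu : f =ᵐ[vol a] u)
    (hv : g =ᵐ[vol a] v) : inner ℂ f g = ∫ x, (starRingEnd ℂ) (u x) * v x ∂(vol a) := by
  rw [MeasureTheory.L2.inner_def]
  refine integral_congr_ae ?_
  filter_upwards [hu, hv] with x h1 h2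
  rw [h1, h2, RCLike.inner_apply, mul_comm]

theorem parity_ae (a : ℝ) (f : L2 a) : parity a f =ᵐ[vol a] fun x => f (-x) :=
  Lp.coeFn_compMeasurePreserving f (measurePreserving_neg_vol a)

theorem parity_ae_of_ae {a : ℝ} {f : L2 a} {u : ℝ → ℂ} (h : f =ᵐ[vol a] u) :
    parity a f =ᵐ[vol a] fun x => u (-x) :=
  (parity_ae a f).trans ((measurePreserving_neg_vol a).quasiMeasurePreserving.ae_eq_comp h)

theorem parity_parity {a : ℝ} (f : L2 a) : parity a (parity a f) = f := by
  refine Lp.ext ?_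
  refine (parity_ae_of_ae (parity_ae a f)).trans ?_
  simp

theorem parity_mul_self (a : ℝ) : parity a * parity a = 1 :=
  ContinuousLinearMap.ext parity_parity

theorem isUnit_parity (a : ℝ) : IsUnit (parity a) :=
  ⟨⟨_, _, parity_mul_self a, parity_mul_self a⟩, rfl⟩

theorem inner_parity_parity {a : ℝ} (f g : L2 a) :
    inner ℂ (parity a f) (parity a g) = inner ℂ f g :=
  (Lp.compMeasurePreservingₗᵢ ℂ (fun x : ℝ => -x) (measurePreserving_neg_vol a)).inner_map_map f g

theorem inner_parity_left {a : ℝ} (f g : L2 a) :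
    inner ℂ (parity a f) g = inner ℂ f (parity a g) := by
  rw [← inner_parity_parity, parity_parity]

/-! ### The graph of the Robin Laplacian -/

section Robin

variable {a : ℝ}

theorem parity_mem_robinGraph (ha : 0 < a) {c d : ℂ} {ψ f : L2 a} (h : (ψ, f) ∈ robinGraph a c d) :
    (parity a ψ, parity a f) ∈ robinGraph a (-d) (-c) := by
  obtain ⟨u, v, h1, h2, h3, h4, h5⟩ := h
  refine ⟨fun x => u (-x), fun x => -v (-x), parity_ae_of_ae h1, h2.comp_neg ha, ?_, ?_, ?_⟩
  · have h := ((h3.comp_neg ha).const_mul (-1))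
    have e : (fun x => -1 * v (-x)) = fun x => -v (-x) := by ext; ring
    rw [e] at h
    refine h.congr ?_
    filter_upwards [parity_ae a f] with x hx
    rw [hx]
    ring
  · linear_combination -h5
  · beta_reduce
    rw [neg_neg]
    linear_combination -h4

theorem parity_mem_robinGraph_iff (ha : 0 < a) {c d : ℂ} {ψ f : L2 a} :
    (parity a ψ, parity a f) ∈ robinGraph a (-d) (-c) ↔ (ψ, f) ∈ robinGraph a c d := by
  refine ⟨fun h => ?_, parity_mem_robinGraph ha⟩
  have := parity_mem_robinGraph ha h
  simpa only [parity_parity, neg_neg] using this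

/-- Green's formula: `-p̄ f + ḡ u` is the derivative of `p̄ v - q̄ u`, and conjugate boundary
constants make this expression vanish at each endpoint. -/
theorem inner_robinGraph (ha : 0 < a) {c d : ℂ} {ψ f η g : L2 a}
    (h : (ψ, f) ∈ robinGraph a c d)
    (h' : (η, g) ∈ robinGraph a ((starRingEnd ℂ) c) ((starRingEnd ℂ) d)) :
    inner ℂ η f = inner ℂ g ψ := by
  obtain ⟨u, v, h1, h2, h3, h4, h5⟩ := h
  obtain ⟨p, q, k1, k2, k3, k4, k5⟩ := h'
  rw [inner_eq_integral k1 (Filter.EventuallyEq.refl _ _),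
    inner_eq_integral (Filter.EventuallyEq.refl _ _) h1]
  have e := ((k2.conj.mul ha h3).add ((k3.conj.mul ha h2).const_mul (-1)))
  have e' := e.integral_eq ha
  have hcq : (starRingEnd ℂ) (q a) = - d * (starRingEnd ℂ) (p a) := by
    have := congrArg (starRingEnd ℂ) k4
    simp only [map_add, map_mul, Complex.conj_conj, map_zero] at this
    linear_combination this
  have hcq' : (starRingEnd ℂ) (q (-a)) = - c * (starRingEnd ℂ) (p (-a)) := by
    have := congrArg (starRingEnd ℂ) k5
    simp only [map_add, map_mul, Complex.conj_conj, map_zero] at this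
    linear_combination this
  have i1 := (k2.conj.mul ha h3).1
  have z : ∫ x, (-((starRingEnd ℂ) (p x) * f x) + (starRingEnd ℂ) (g x) * u x) ∂(vol a) = 0 := by
    refine Eq.trans (integral_congr_ae (Filter.Eventually.of_forall fun x => ?_)) (e'.trans ?_)
    · simp only [map_neg]
      ring
    · rw [hcq, hcq']
      linear_combination (starRingEnd ℂ (p a)) * h4 - (starRingEnd ℂ (p (-a))) * h5
  have j1 : Integrable (fun x => (starRingEnd ℂ) (p x) * f x) (vol a) :=
    IntegrableOn.continuousOn_mul_of_subset k2.conj.continuousOn (L2.integrable f) isCompact_Icc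
      measurableSet_Ioo Set.Ioo_subset_Icc_self
  have j2 : Integrable (fun x => (starRingEnd ℂ) (g x) * u x) (vol a) :=
    IntegrableOn.mul_continuousOn_of_subset
      (Complex.conjCLE.toContinuousLinearMap.integrable_comp (L2.integrable g)) h2.continuousOn
      measurableSet_Ioo isCompact_Icc Set.Ioo_subset_Icc_self
  rw [integral_add (f := fun x => -((starRingEnd ℂ) (p x) * f x)) j1.neg j2, integral_neg] at z
  linear_combination -z

/-- Two integrations solve `ψ'' = -f`; for `c ≠ 0` the two remaining constants can be fitted to the
boundary conditions. -/
theorem exists_mem_robinGraph (ha : 0 < a) {c : ℂ} (hc : c ≠ 0) (f : L2 a) :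
    ∃ ψ, (ψ, f) ∈ robinGraph a c c := by
  have hf : Integrable (fun x => -(f x)) (vol a) := (L2.integrable f).neg
  let w : ℝ → ℂ := fun x => ∫ t in (-a)..x, -(f t)
  have hw0 : w (-a) = 0 := by simp [w]
  have hw : IsPrimitive a w (fun x => -(f x)) := by
    simpa only [zero_add] using IsPrimitive.intervalIntegral hf 0
  let W : ℝ → ℂ := fun x => ∫ t in (-a)..x, w t
  have hW0 : W (-a) = 0 := by simp [W]
  have hW : IsPrimitive a W w := by
    simpa only [zero_add] using
      IsPrimitive.intervalIntegral (ContinuousOn.integrable_vol hw.continuousOn) 0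
  have ha' : (a : ℂ) ≠ 0 := by exact_mod_cast ha.ne'
  -- The affine correction `s - c s (x + a)` satisfies the condition at `-a` for every `s`. The
  -- condition at `a` reads `w(a) + c W(a) = 2 a c² s`.
  let s : ℂ := (w a + c * W a) / (2 * a * c ^ 2)
  have hs : s * (2 * a * c ^ 2) = w a + c * W a := div_mul_cancel₀ _ (by simp [ha', hc])
  have hl : IsPrimitive a (fun x => s + (-c * s) * (x + a)) (fun _ => -c * s) := by
    refine IsPrimitive.of_hasDerivAt (fun x => ?_) continuous_const
    simpa using (((Complex.ofRealCLM.hasDerivAt (x := x)).add_const (a : ℂ)).const_mul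
      (-c * s)).const_add s
  have hk : IsPrimitive a (fun _ => -c * s) (fun _ => 0) :=
    IsPrimitive.of_hasDerivAt (fun x => hasDerivAt_const x _) continuous_const
  have hu := hl.add hW
  have hv := hk.add hw
  simp only [zero_add] at hv
  have hmem : MemLp (fun x : ℝ => s + (-c * s) * (x + a) + W x) 2 (vol a) :=
    ContinuousOn.memLp_vol hu.continuousOn
  refine ⟨hmem.toLp, _, _, hmem.coeFn_toLp, hu, hv, ?_, ?_⟩
  · linear_combination -hs
  · simp only [hw0, hW0]
    push_cast
    ring

end Robin

/-! ### Completeness of the cosines -/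

section Cosine

variable {a : ℝ}

/-- The affine bijection of `[-a,a]` onto `[0,π]`. -/
def angle (a x : ℝ) : ℝ := Real.pi / (2 * a) * (x + a)

theorem kn_mul (a : ℝ) (n : ℕ) (x : ℝ) : kn a n * (x + a) = n * angle a x := by
  unfold kn angle
  ring

theorem continuous_angle (a : ℝ) : Continuous (angle a) := by
  unfold angle
  fun_prop

theorem angle_mem (ha : 0 < a) {x : ℝ} (hx : x ∈ Set.Icc (-a) a) :
    angle a x ∈ Set.Icc 0 Real.pi := by
  have hp := Real.pi_pos
  constructor
  · exact mul_nonneg (by positivity) (by linarith [hx.1])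
  · have : angle a x ≤ Real.pi / (2 * a) * (a + a) :=
      mul_le_mul_of_nonneg_left (by linarith [hx.2]) (by positivity)
    refine this.trans_eq ?_
    field_simp
    ring

@[simp] theorem angle_left (a : ℝ) : angle a (-a) = 0 := by simp [angle]

theorem angle_right (ha : 0 < a) : angle a a = Real.pi := by
  unfold angle
  field_simp
  ring

theorem hasDerivAt_angle (a x : ℝ) : HasDerivAt (angle a) (Real.pi / (2 * a)) x := by
  have := ((hasDerivAt_id x).add_const a).const_mul (Real.pi / (2 * a))
  rw [mul_one] at this
  exact this

theorem integral_cos_int_mul_angle (ha : 0 < a) {m : ℤ} (hm : m ≠ 0) :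
    ∫ x, ((Real.cos (m * angle a x) : ℝ) : ℂ) ∂(vol a) = 0 := by
  have hp := Real.pi_pos
  have hm' : (m : ℝ) ≠ 0 := by exact_mod_cast hm
  have h : IsPrimitive a (fun x => ((Real.sin (m * angle a x) / (m * (Real.pi / (2 * a))) : ℝ) : ℂ))
      (fun x => ((Real.cos (m * angle a x) : ℝ) : ℂ)) := by
    refine IsPrimitive.of_hasDerivAt (fun x => ?_) ?_
    · have := (((hasDerivAt_angle a x).const_mul (m : ℝ)).sin.div_const
        (m * (Real.pi / (2 * a)))).ofReal_comp
      convert! this using 2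
      field_simp
    · have := continuous_angle a
      fun_prop
  rw [h.integral_eq ha, angle_right ha, angle_left, Real.sin_int_mul_pi]
  simp

theorem integral_cos_mul_angle (ha : 0 < a) (m : ℤ) :
    ∫ x, ((Real.cos (m * angle a x) : ℝ) : ℂ) ∂(vol a) = if m = 0 then 2 * (a : ℂ) else 0 := by
  split_ifs with hm
  · subst hm
    simp only [Int.cast_zero, zero_mul, Real.cos_zero, Complex.ofReal_one, integral_const]
    rw [Measure.real, Measure.restrict_apply MeasurableSet.univ, Set.univ_inter,
      Real.volume_Ioo, ENNReal.toReal_ofReal (by linarith), Complex.real_smul]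
    push_cast
    ring
  · exact integral_cos_int_mul_angle ha hm

/-- Product formulas pass from `cos nθ` to powers of `cos θ`, Weierstrass approximation in `t = cos
θ` passes to all continuous test functions, and the fundamental lemma of the calculus of variations
concludes. -/
theorem ae_eq_zero_of_integral_mul_cos (ha : 0 < a) {g : ℝ → ℂ} (hg : Integrable g (vol a))
    (h : ∀ n : ℕ, ∫ x, g x * (Real.cos (n * angle a x) : ℝ) ∂(vol a) = 0) :
    g =ᵐ[vol a] fun _ => 0 := by
  have hca := continuous_angle a
  have hint : ∀ k : ℝ → ℝ, Continuous k → Integrable (fun x => g x * (k x : ℂ)) (vol a) :=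
    fun k hk => IntegrableOn.mul_continuousOn_of_subset hg
      (Complex.continuous_ofReal.comp hk).continuousOn measurableSet_Ioo isCompact_Icc
      Set.Ioo_subset_Icc_self
  have hz : ∀ j : ℤ, ∫ x, g x * (Real.cos (j * angle a x) : ℝ) ∂(vol a) = 0 := by
    intro j
    obtain ⟨k, rfl | rfl⟩ := j.eq_nat_or_neg
    · simpa only [Int.cast_natCast] using h k
    · simpa only [Int.cast_neg, neg_mul, Real.cos_neg, Int.cast_natCast] using h k
  -- The induction on `m` carries an arbitrary integer `j`, since one factor `cos θ` shifts `j` to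
  -- both `j + 1` and `j - 1`.
  have hA : ∀ (m : ℕ) (j : ℤ), ∫ x, g x *
      ((Real.cos (angle a x) ^ m * Real.cos (j * angle a x) : ℝ) : ℂ) ∂(vol a) = 0 := by
    intro m
    induction m with
    | zero => simpa using hz
    | succ m ih =>
      intro j
      have e : ∀ x, g x * ((Real.cos (angle a x) ^ (m + 1) * Real.cos (j * angle a x) : ℝ) : ℂ) =
          2⁻¹ * (g x * ((Real.cos (angle a x) ^ m * Real.cos ((j + 1 : ℤ) * angle a x) : ℝ) : ℂ) +
          g x * ((Real.cos (angle a x) ^ m * Real.cos ((j - 1 : ℤ) * angle a x) : ℝ) : ℂ)) := by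
        intro x
        have h1 : Real.cos (angle a x) * Real.cos (j * angle a x) =
            2⁻¹ * (Real.cos ((j + 1 : ℤ) * angle a x) + Real.cos ((j - 1 : ℤ) * angle a x)) := by
          push_cast
          rw [add_mul, sub_mul, one_mul, Real.cos_add, Real.cos_sub]
          ring
        rw [pow_succ, mul_assoc, h1]
        push_cast
        ring
      simp_rw [e]
      rw [integral_const_mul, integral_add (hint _ (by fun_prop)) (hint _ (by fun_prop)), ih, ih]
      simp
  have hB : ∀ p : Polynomial ℝ, ∫ x, g x * (p.eval (Real.cos (angle a x)) : ℝ) ∂(vol a) = 0 := by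
    intro p
    induction p using Polynomial.induction_on' with
    | add p q hp hq =>
      simp_rw [Polynomial.eval_add, Complex.ofReal_add, mul_add]
      rw [integral_add (hint _ (by fun_prop)) (hint _ (by fun_prop)), hp, hq, add_zero]
    | monomial n c =>
      have e : ∀ x, g x * ((Polynomial.monomial n c).eval (Real.cos (angle a x)) : ℝ) =
          c * (g x * ((Real.cos (angle a x) ^ n * Real.cos ((0 : ℤ) * angle a x) : ℝ) : ℂ)) := by
        intro x
        simp only [Polynomial.eval_monomial, Int.cast_zero, zero_mul, Real.cos_zero, mul_one]
        push_cast
        ring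
      simp_rw [e]
      rw [integral_const_mul, hA, mul_zero]
  have hC : ∀ k : ℝ → ℝ, Continuous k → ∫ x, g x * (k x : ℂ) ∂(vol a) = 0 := by
    intro k hk
    have hM : 0 ≤ ∫ x, ‖g x‖ ∂(vol a) := integral_nonneg fun x => norm_nonneg _
    rw [← norm_le_zero_iff]
    refine le_of_forall_pos_le_add fun ε hε => ?_
    set M := ∫ x, ‖g x‖ ∂(vol a) with hMdef
    -- The function approximated is `k` in the variable `t = cos θ`, with `x = (2a/π) arccos t - a`.
    -- The `+ 1` in `ε / (M + 1)` covers the case `M = 0`.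
    obtain ⟨p, hp⟩ := exists_polynomial_near_of_continuousOn (-1) 1
      (fun t => k (2 * a / Real.pi * Real.arccos t - a))
      (Continuous.continuousOn (by have := Real.continuous_arccos; fun_prop)) (ε / (M + 1))
      (by positivity)
    have hnear : ∀ x ∈ Set.Ioo (-a) a, |k x - p.eval (Real.cos (angle a x))| ≤ ε / (M + 1) := by
      intro x hx
      have hm := angle_mem ha (Set.Ioo_subset_Icc_self hx)
      have := hp (Real.cos (angle a x)) ⟨Real.neg_one_le_cos _, Real.cos_le_one _⟩
      rw [Real.arccos_cos hm.1 hm.2] at this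
      have e : 2 * a / Real.pi * angle a x - a = x := by
        unfold angle
        have := Real.pi_pos
        field_simp
        ring
      rw [e, abs_sub_comm] at this
      exact this.le
    have e : ∫ x, g x * (k x : ℂ) ∂(vol a) =
        ∫ x, g x * ((k x - p.eval (Real.cos (angle a x)) : ℝ) : ℂ) ∂(vol a) := by
      simp_rw [Complex.ofReal_sub, mul_sub]
      rw [integral_sub (hint _ hk) (hint _ (by fun_prop)), hB, sub_zero]
    rw [e, zero_add]
    calc ‖∫ x, g x * ((k x - p.eval (Real.cos (angle a x)) : ℝ) : ℂ) ∂(vol a)‖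
        ≤ ∫ x, ‖g x‖ * (ε / (M + 1)) ∂(vol a) := by
          refine norm_integral_le_of_norm_le (hg.norm.mul_const _) ?_
          refine (ae_restrict_iff' measurableSet_Ioo).2 (Filter.Eventually.of_forall fun x hx => ?_)
          rw [norm_mul, Complex.norm_real]
          exact mul_le_mul_of_nonneg_left (hnear x hx) (norm_nonneg _)
      _ = M * (ε / (M + 1)) := by rw [integral_mul_const]
      _ ≤ ε := by
          rw [mul_div_assoc', div_le_iff₀ (by positivity)]
          nlinarith
  have := isOpen_Ioo.ae_eq_zero_of_integral_contDiff_smul_eq_zero (μ := volume)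
    (f := g) (U := Set.Ioo (-a) a) (IntegrableOn.locallyIntegrableOn hg) (fun k hk _ hs => by
      have h1 := hC k hk.continuous
      rw [← h1, ← setIntegral_eq_integral_of_forall_compl_eq_zero (s := Set.Ioo (-a) a)]
      · refine integral_congr_ae (Filter.Eventually.of_forall fun x => ?_)
        simp only [Complex.real_smul]
        ring
      · intro x hx
        have : k x = 0 := image_eq_zero_of_notMem_tsupport fun hx' => hx (hs hx')
        simp [this])
  exact (ae_restrict_iff' measurableSet_Ioo).2 this

/-- Subtracting the mean value makes the remaining case `n = 0` vanish too, without disturbing the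
others. -/
theorem ae_eq_const_of_integral_mul_cos (ha : 0 < a) {g : ℝ → ℂ} (hg : Integrable g (vol a))
    (h : ∀ n : ℕ, n ≠ 0 → ∫ x, g x * (Real.cos (n * angle a x) : ℝ) ∂(vol a) = 0) :
    ∃ c : ℂ, g =ᵐ[vol a] fun _ => c := by
  let c : ℂ := (∫ x, g x ∂(vol a)) / (2 * a)
  have hca := continuous_angle a
  have ha' : (a : ℂ) ≠ 0 := by exact_mod_cast ha.ne'
  have hcint : ∀ k : ℝ → ℝ, Continuous k → Integrable (fun x => c * (k x : ℂ)) (vol a) :=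
    fun k hk => ContinuousOn.integrable_vol (by fun_prop)
  have hint : ∀ k : ℝ → ℝ, Continuous k → Integrable (fun x => g x * (k x : ℂ)) (vol a) :=
    fun k hk => IntegrableOn.mul_continuousOn_of_subset hg
      (Complex.continuous_ofReal.comp hk).continuousOn measurableSet_Ioo isCompact_Icc
      Set.Ioo_subset_Icc_self
  refine ⟨c, ?_⟩
  have := ae_eq_zero_of_integral_mul_cos ha (g := fun x => g x - c)
    (hg.sub (integrable_const c)) (fun n => by
      simp_rw [sub_mul]
      rw [integral_sub (hint _ (by fun_prop)) (hcint _ (by fun_prop)), integral_const_mul]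
      have hcos := integral_cos_mul_angle ha n
      rw [Int.cast_natCast] at hcos
      rw [hcos]
      by_cases hn : n = 0
      · subst hn
        simp only [Nat.cast_zero, zero_mul, Real.cos_zero, Complex.ofReal_one, mul_one, if_true, c]
        field_simp
        ring
      · rw [h n hn, if_neg (by exact_mod_cast hn), mul_zero, sub_zero])
  filter_upwards [this] with x hx
  exact sub_eq_zero.1 hx

end Cosine

/-! ### The eigenfunctions -/

section Eigenfunctions

variable {a α : ℝ}

theorem phi_ae (a α : ℝ) (n : ℕ) : phi a α n =ᵐ[vol a] phiFun a α n :=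
  (memLp_phiFun a α n).coeFn_toLp

theorem sqrt_mul_sqrt (ha : 0 < a) : ((1 / √a : ℝ) : ℂ) * ((1 / √a : ℝ) : ℂ) = 1 / a := by
  rw [← Complex.ofReal_mul, div_mul_div_comm, Real.mul_self_sqrt ha.le]
  push_cast
  ring

theorem kn_pos (ha : 0 < a) {n : ℕ} (hn : n ≠ 0) : 0 < kn a n := by
  have : (0 : ℝ) < n := by exact_mod_cast Nat.pos_of_ne_zero hn
  have := Real.pi_pos
  unfold kn
  positivity

theorem kn_strictMono (ha : 0 < a) : StrictMono (kn a) := by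
  intro m n hmn
  have : (m : ℝ) < n := by exact_mod_cast hmn
  have := Real.pi_pos
  unfold kn
  gcongr

theorem lt_kn (ha : 0 < a) (hα' : α < Real.pi / (2 * a)) {n : ℕ} (hn : n ≠ 0) : α < kn a n := by
  have h1 : kn a 1 = Real.pi / (2 * a) := by simp [kn]
  exact (hα'.trans_eq h1.symm).trans_le
    ((kn_strictMono ha).monotone (Nat.one_le_iff_ne_zero.2 hn))

theorem phiFun_zero (a α x : ℝ) : phiFun a α 0 x =
    ((1 / √(2 * a) : ℝ) : ℂ) * Complex.exp (Complex.I * α * (x + a)) := by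
  simp [phiFun]

theorem phiFun_of_ne_zero (a α : ℝ) {n : ℕ} (hn : n ≠ 0) (x : ℝ) : phiFun a α n x =
    ((1 / √a : ℝ) : ℂ) * (((Real.cos (n * angle a x) : ℝ) : ℂ) +
      Complex.I * (α / kn a n) * ((Real.sin (n * angle a x) : ℝ) : ℂ)) := by
  simp only [phiFun, chiN, chiD, if_neg hn, kn_mul]
  push_cast
  ring

theorem phiFun_neg (ha : 0 < a) (α : ℝ) {n : ℕ} (hn : n ≠ 0) (x : ℝ) : phiFun a α n (-x) =
    (-1) ^ n * (((1 / √a : ℝ) : ℂ) * (((Real.cos (n * angle a x) : ℝ) : ℂ) -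
      Complex.I * (α / kn a n) * ((Real.sin (n * angle a x) : ℝ) : ℂ))) := by
  have e : angle a (-x) = Real.pi - angle a x := by
    unfold angle
    field_simp
    ring
  rw [phiFun_of_ne_zero a α hn, e, mul_sub, Real.cos_nat_mul_pi_sub, Real.sin_nat_mul_pi_sub]
  push_cast
  ring

theorem isPrimitive_sin (a : ℝ) (n : ℕ) :
    IsPrimitive a (fun x => ((Real.sin (n * angle a x) : ℝ) : ℂ))
      (fun x => kn a n * ((Real.cos (n * angle a x) : ℝ) : ℂ)) := by
  have hc := continuous_angle a
  refine IsPrimitive.of_hasDerivAt (fun x => ?_) (by fun_prop)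
  convert! ((hasDerivAt_angle a x).const_mul (n : ℝ)).sin.ofReal_comp using 1
  unfold kn
  push_cast
  ring

theorem isPrimitive_cos (a : ℝ) (n : ℕ) :
    IsPrimitive a (fun x => ((Real.cos (n * angle a x) : ℝ) : ℂ))
      (fun x => -kn a n * ((Real.sin (n * angle a x) : ℝ) : ℂ)) := by
  have hc := continuous_angle a
  refine IsPrimitive.of_hasDerivAt (fun x => ?_) (by fun_prop)
  convert! ((hasDerivAt_angle a x).const_mul (n : ℝ)).cos.ofReal_comp using 1
  unfold kn
  push_cast
  ring

theorem isPrimitive_exp (a : ℝ) (c d : ℂ) :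
    IsPrimitive a (fun x => Complex.exp (c * (x + d))) (fun x => c * Complex.exp (c * (x + d))) := by
  refine IsPrimitive.of_hasDerivAt (fun x => ?_) (by fun_prop)
  convert! (((Complex.ofRealCLM.hasDerivAt (x := x)).add_const d).const_mul c).cexp using 1
  simp
  ring

theorem phi_mem_robinGraph (ha : 0 < a) (α : ℝ) (n : ℕ) :
    (phi a α n, (eigenvalue a α n : ℂ) • phi a α n) ∈
      robinGraph a (-(Complex.I * α)) (-(Complex.I * α)) := by
  have hae : (fun x => -((eigenvalue a α n : ℂ) * phiFun a α n x)) =ᵐ[vol a]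
      fun x => -(((eigenvalue a α n : ℂ) • phi a α n : L2 a) x) := by
    filter_upwards [Lp.coeFn_smul (eigenvalue a α n : ℂ) (phi a α n), phi_ae a α n] with x h1 h2
    rw [h1, Pi.smul_apply, h2, smul_eq_mul]
  by_cases hn : n = 0
  · subst hn
    have e : phiFun a α 0 = fun x : ℝ =>
        ((1 / √(2 * a) : ℝ) : ℂ) * Complex.exp (Complex.I * α * (x + a)) :=
      funext (phiFun_zero a α)
    have h1 := (isPrimitive_exp a (Complex.I * α) a).const_mul ((1 / √(2 * a) : ℝ) : ℂ)
    have h2 := h1.const_mul (Complex.I * α)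
    refine ⟨phiFun a α 0, fun x => Complex.I * α * phiFun a α 0 x, phi_ae a α 0, ?_, ?_, ?_, ?_⟩
    · rw [e]
      convert h1 using 2
      ring
    · refine IsPrimitive.congr ?_ hae
      rw [e]
      convert h2 using 2
      simp only [eigenvalue, if_true, Complex.ofReal_pow]
      linear_combination (-(α : ℂ) ^ 2 * ((1 / √(2 * a) : ℝ) : ℂ) *
        Complex.exp (Complex.I * α * (_ + a))) * Complex.I_sq
    · ring
    · ring
  · have hk : (kn a n : ℂ) ≠ 0 := by exact_mod_cast (kn_pos ha hn).ne'
    have e : phiFun a α n = _ := funext (phiFun_of_ne_zero a α hn)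
    have h1 := ((isPrimitive_cos a n).add ((isPrimitive_sin a n).const_mul
      (Complex.I * (α / kn a n)))).const_mul ((1 / √a : ℝ) : ℂ)
    have h2 := (((isPrimitive_sin a n).const_mul (-kn a n)).add ((isPrimitive_cos a n).const_mul
      (Complex.I * α))).const_mul ((1 / √a : ℝ) : ℂ)
    refine ⟨phiFun a α n, _, phi_ae a α n, ?_, h2.congr (Filter.EventuallyEq.trans ?_ hae), ?_, ?_⟩
    · rw [e]
      convert h1 using 2
      field_simp
    · refine Filter.Eventually.of_forall fun x => ?_
      simp only [e, eigenvalue, if_neg hn]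
      push_cast
      field_simp
      ring
    · simp only [e, angle_right ha, Real.sin_nat_mul_pi]
      push_cast
      ring
    · simp only [e, angle_left, mul_zero, Real.sin_zero]
      push_cast
      ring

/-! ### Biorthogonality and completeness of `φ_n` and `P φ_n` -/

theorem parity_phi_mem_robinGraph (ha : 0 < a) (α : ℝ) (n : ℕ) :
    (parity a (phi a α n), (eigenvalue a α n : ℂ) • parity a (phi a α n)) ∈
      robinGraph a (Complex.I * α) (Complex.I * α) := by
  have := parity_mem_robinGraph ha (phi_mem_robinGraph ha α n)
  simpa only [neg_neg, map_smul] using this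

/-- The value of `⟨φ_n, P φ_n⟩`. -/
def overlap (a α : ℝ) (n : ℕ) : ℝ :=
  if n = 0 then Real.sin (2 * α * a) / (2 * α * a) else (-1) ^ n * (1 - α ^ 2 / kn a n ^ 2)

theorem inner_phi_parity_phi_self (ha : 0 < a) (hα : 0 < α) (n : ℕ) :
    inner ℂ (phi a α n) (parity a (phi a α n)) = (overlap a α n : ℂ) := by
  have ha' : (a : ℂ) ≠ 0 := by exact_mod_cast ha.ne'
  have hα' : (α : ℂ) ≠ 0 := by exact_mod_cast hα.ne'
  rw [inner_eq_integral (phi_ae a α n) (parity_ae_of_ae (phi_ae a α n))]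
  by_cases hn : n = 0
  · subst hn
    have h := (isPrimitive_exp a (-2 * Complex.I * α) 0).const_mul
      (1 / (2 * a) / (-2 * Complex.I * α))
    have e : ∀ x : ℝ, (starRingEnd ℂ) (phiFun a α 0 x) * phiFun a α 0 (-x) =
        1 / (2 * a) / (-2 * Complex.I * α) *
          (-2 * Complex.I * α * Complex.exp (-2 * Complex.I * α * (x + 0))) := by
      intro x
      have hs : ((1 / √(2 * a) : ℝ) : ℂ) * ((1 / √(2 * a) : ℝ) : ℂ) = 1 / (2 * a) := by
        rw [← Complex.ofReal_mul, div_mul_div_comm, Real.mul_self_sqrt (by positivity)]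
        push_cast
        ring
      rw [phiFun_zero, phiFun_zero, map_mul, Complex.conj_ofReal, ← Complex.exp_conj]
      simp only [map_mul, map_add, Complex.conj_ofReal, Complex.conj_I]
      rw [mul_mul_mul_comm, hs, ← Complex.exp_add]
      have : -Complex.I * α * (x + a) + Complex.I * α * ((-x : ℝ) + a) =
          -2 * Complex.I * α * (x + 0) := by
        push_cast
        ring
      rw [this]
      have := Complex.I_ne_zero
      field_simp
    simp_rw [e]
    rw [h.integral_eq ha]
    simp only [overlap, if_true]
    push_cast
    rw [Complex.sin]
    have e1 : -2 * Complex.I * α * ((a : ℂ) + 0) = -(2 * α * a) * Complex.I := by ring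
    have e2 : -2 * Complex.I * α * (-(a : ℂ) + 0) = 2 * α * a * Complex.I := by ring
    rw [e1, e2]
    have := Complex.I_ne_zero
    field_simp
    rw [Complex.I_sq]
    ring
  · have hk : (kn a n : ℂ) ≠ 0 := by exact_mod_cast (kn_pos ha hn).ne'
    have hlin : IsPrimitive a (fun x => (x : ℂ)) (fun _ => 1) :=
      IsPrimitive.of_hasDerivAt (fun x => Complex.ofRealCLM.hasDerivAt (x := x))
        continuous_const
    have hS := isPrimitive_sin a n
    -- With `β = α/k_n`, the integrand is `(-1)^n/a` times `(cos - iβ sin)² = (1-β²)/2 + (1+β²)/2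
    -- (cos² - sin²) - 2iβ sin cos`. Of the antiderivative only the linear term survives at the
    -- endpoints.
    have h := ((hlin.const_mul ((1 - (α / kn a n) ^ 2) / 2)).add
      (((hS.mul ha (isPrimitive_cos a n)).const_mul ((1 + (α / kn a n) ^ 2) / (2 * kn a n))).add
      ((hS.mul ha hS).const_mul (-Complex.I * (α / kn a n) / kn a n)))).const_mul ((-1) ^ n / a)
    refine Eq.trans (integral_congr_ae (Filter.Eventually.of_forall fun x => ?_))
      ((h.integral_eq ha).trans ?_)
    · beta_reduce
      rw [phiFun_neg ha α hn, phiFun_of_ne_zero a α hn]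
      simp only [map_mul, map_add, map_div₀, Complex.conj_ofReal, Complex.conj_I]
      have hcs : ((Real.cos (n * angle a x) : ℝ) : ℂ) ^ 2 +
          ((Real.sin (n * angle a x) : ℝ) : ℂ) ^ 2 = 1 := by
        exact_mod_cast Real.cos_sq_add_sin_sq _
      generalize ((Real.cos (n * angle a x) : ℝ) : ℂ) = c at *
      generalize ((Real.sin (n * angle a x) : ℝ) : ℂ) = s at *
      have : ∀ A B : ℂ, ((1 / √a : ℝ) : ℂ) * A * ((-1) ^ n * (((1 / √a : ℝ) : ℂ) * B)) =
          (-1) ^ n / a * (A * B) := by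
        intro A B
        linear_combination (A * B * (-1) ^ n) * sqrt_mul_sqrt ha
      rw [this]
      congr 1
      field_simp
      linear_combination (kn a n ^ 2 - α ^ 2 : ℂ) * hcs + 2 * α ^ 2 * s ^ 2 * Complex.I_sq
    · simp only [angle_right ha, angle_left, mul_zero, Real.sin_zero, Real.sin_nat_mul_pi,
        overlap, if_neg hn]
      push_cast
      field_simp
      ring

theorem overlap_zero_pos (ha : 0 < a) (hα : 0 < α) (hα' : α < Real.pi / (2 * a)) :
    0 < overlap a α 0 := by
  rw [lt_div_iff₀ (by positivity)] at hα'
  simp only [overlap, if_true]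
  exact div_pos (Real.sin_pos_of_pos_of_lt_pi (by positivity) (by linarith)) (by positivity)

theorem one_sub_pos (ha : 0 < a) (hα : 0 < α) (hα' : α < Real.pi / (2 * a)) {n : ℕ}
    (hn : n ≠ 0) : 0 < 1 - α ^ 2 / kn a n ^ 2 := by
  have h := lt_kn ha hα' hn
  have hk := kn_pos ha hn
  rw [sub_pos, div_lt_one (by positivity)]
  gcongr

theorem overlap_ne_zero (ha : 0 < a) (hα : 0 < α) (hα' : α < Real.pi / (2 * a)) (n : ℕ) :
    overlap a α n ≠ 0 := by
  by_cases hn : n = 0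
  · subst hn
    exact (overlap_zero_pos ha hα hα').ne'
  · simp only [overlap, if_neg hn]
    exact mul_ne_zero (by simp) (one_sub_pos ha hα hα' hn).ne'

theorem phi_ne_zero (ha : 0 < a) (hα : 0 < α) (hα' : α < Real.pi / (2 * a)) (n : ℕ) :
    phi a α n ≠ 0 := by
  intro h
  have := inner_phi_parity_phi_self ha hα n
  rw [h, inner_zero_left] at this
  exact overlap_ne_zero ha hα hα' n (by exact_mod_cast this.symm)

theorem eigenvalue_injective (ha : 0 < a) (hα : 0 < α) (hα' : α < Real.pi / (2 * a)) :
    Function.Injective (eigenvalue a α) := by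
  have key : ∀ n, eigenvalue a α n = (if n = 0 then α else kn a n) ^ 2 := by
    intro n
    unfold eigenvalue
    split_ifs <;> rfl
  intro m n h
  rw [key, key] at h
  by_cases hm : m = 0 <;> by_cases hn : n = 0
  · rw [hm, hn]
  · rw [if_pos hm, if_neg hn, pow_left_inj₀ hα.le (kn_pos ha hn).le two_ne_zero] at h
    exact absurd h (lt_kn ha hα' hn).ne
  · rw [if_pos hn, if_neg hm, pow_left_inj₀ (kn_pos ha hm).le hα.le two_ne_zero] at h
    exact absurd h.symm (lt_kn ha hα' hm).ne
  · rw [if_neg hn, if_neg hm, pow_left_inj₀ (kn_pos ha hm).le (kn_pos ha hn).le two_ne_zero] at h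
    exact (kn_strictMono ha).injective h

theorem inner_phi_robinGraph (ha : 0 < a) {ψ f : L2 a} (n : ℕ)
    (h : (ψ, f) ∈ robinGraph a (Complex.I * α) (Complex.I * α)) :
    inner ℂ (phi a α n) f = (eigenvalue a α n : ℂ) * inner ℂ (phi a α n) ψ := by
  have hc : (starRingEnd ℂ) (Complex.I * α) = -(Complex.I * α) := by simp
  have := inner_robinGraph ha h (by rw [hc]; exact phi_mem_robinGraph ha α n)
  rw [this, inner_smul_left, Complex.conj_ofReal]

/-- For `m ≠ n` these are eigenvectors of an operator and of its formal adjoint with distinct real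
eigenvalues, hence orthogonal. -/
theorem inner_phi_parity_phi (ha : 0 < a) (hα : 0 < α) (hα' : α < Real.pi / (2 * a)) (m n : ℕ) :
    inner ℂ (phi a α m) (parity a (phi a α n)) = if m = n then (overlap a α n : ℂ) else 0 := by
  split_ifs with hmn
  · rw [hmn, inner_phi_parity_phi_self ha hα n]
  · have := inner_phi_robinGraph (α := α) ha m (parity_phi_mem_robinGraph ha α n)
    rw [inner_smul_right] at this
    have hne : (eigenvalue a α m : ℂ) ≠ eigenvalue a α n := by
      exact_mod_cast (eigenvalue_injective ha hα hα').ne hmn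
    have h0 : ((eigenvalue a α m : ℂ) - eigenvalue a α n) *
        inner ℂ (phi a α m) (parity a (phi a α n)) = 0 := by
      linear_combination -this
    exact (mul_eq_zero.1 h0).resolve_left (sub_ne_zero.2 hne)

/-- The eigenfunctions `φ_n` are complete. -/
theorem eq_zero_of_inner_phi (ha : 0 < a) (hα : 0 < α) (hα' : α < Real.pi / (2 * a)) {f : L2 a}
    (hf : ∀ n, inner ℂ (phi a α n) f = 0) : f = 0 := by
  have hfi := L2.integrable f
  -- The primitive of `f` vanishing at `a`, so that the boundary terms of `sin · F` drop out.
  -- Orthogonality to `φ_n` then says that `f + iαF` is orthogonal to `cos nθ` for `n ≥ 1`.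
  let F : ℝ → ℂ := fun x => -(∫ t in (-a)..a, f t) + ∫ t in (-a)..x, f t
  have hF : IsPrimitive a F f := IsPrimitive.intervalIntegral hfi _
  have hFa : F a = 0 := by simp [F]
  have hFi : Integrable F (vol a) := ContinuousOn.integrable_vol hF.continuousOn
  obtain ⟨c, hc⟩ := ae_eq_const_of_integral_mul_cos ha (g := fun x => f x + Complex.I * α * F x)
    (hfi.add (hFi.const_mul _)) (fun n hn => by
      have hk : (kn a n : ℂ) ≠ 0 := by exact_mod_cast (kn_pos ha hn).ne'
      have hs : ((√a : ℝ) : ℂ) ≠ 0 := by exact_mod_cast (Real.sqrt_pos.2 ha).ne'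
      have h1 := hf n
      rw [inner_eq_integral (phi_ae a α n) (Filter.EventuallyEq.refl _ _)] at h1
      have i1 : Integrable (fun x => (starRingEnd ℂ) (phiFun a α n x) * f x) (vol a) :=
        IntegrableOn.continuousOn_mul_of_subset
          (Complex.continuous_conj.comp (continuous_phiFun a α n)).continuousOn hfi isCompact_Icc
          measurableSet_Ioo Set.Ioo_subset_Icc_self
      have h2 := (isPrimitive_sin a n).mul ha hF
      have h3 := h2.integral_eq ha
      rw [hFa, angle_left] at h3
      have e : ∀ x, (f x + Complex.I * α * F x) * ((Real.cos (n * angle a x) : ℝ) : ℂ) =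
          (√a : ℝ) * ((starRingEnd ℂ) (phiFun a α n x) * f x) +
          Complex.I * (α / kn a n) * (kn a n * ((Real.cos (n * angle a x) : ℝ) : ℂ) * F x +
            ((Real.sin (n * angle a x) : ℝ) : ℂ) * f x) := by
        intro x
        rw [phiFun_of_ne_zero a α hn]
        simp only [map_mul, map_add, map_div₀, Complex.conj_ofReal, Complex.conj_I]
        push_cast
        field_simp
        ring
      simp_rw [e]
      rw [integral_add (i1.const_mul _) (h2.1.const_mul _), integral_const_mul,
        integral_const_mul, h1, h3]
      simp)
  -- Almost everywhere `f = c - iαF`, and the right-hand side `u` satisfies `u' = -iαu`. Hence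
  -- `e^{iαx} u` is a constant `A`, and `f = A e^{-iαx}` is a multiple of `P φ_0`.
  have hu : IsPrimitive a (fun x => c + -(Complex.I * α) * F x)
      (fun x => -(Complex.I * α) * (c + -(Complex.I * α) * F x)) := by
    have hk : IsPrimitive a (fun _ => c) (fun _ => 0) :=
      IsPrimitive.of_hasDerivAt (fun x => hasDerivAt_const x _) continuous_const
    refine (hk.add (hF.const_mul (-(Complex.I * α)))).congr ?_
    filter_upwards [hc] with x hx
    rw [← hx]
    ring
  have hconst := (isPrimitive_exp a (Complex.I * α) 0).mul ha hu
  let A := Complex.exp (Complex.I * α * ((-a : ℝ) + 0)) * (c + -(Complex.I * α) * F (-a))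
  have hA : ∀ x ∈ Set.Icc (-a) a,
      Complex.exp (Complex.I * α * (x + 0)) * (c + -(Complex.I * α) * F x) = A := by
    intro x hx
    have := hconst.2 x hx
    beta_reduce at this
    rw [this, add_eq_left, intervalIntegral.integral_congr (g := fun _ => 0)
      (fun t _ => by ring), intervalIntegral.integral_zero]
  have hs : ((√(2 * a) : ℝ) : ℂ) ≠ 0 := by
    exact_mod_cast (Real.sqrt_pos.2 (by positivity : 0 < 2 * a)).ne'
  let B := A * (√(2 * a) : ℝ) * Complex.exp (-(Complex.I * α * a))
  have hB : f = B • parity a (phi a α 0) := by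
    refine Lp.ext ?_
    filter_upwards [hc, Lp.coeFn_smul B (parity a (phi a α 0)),
      parity_ae_of_ae (phi_ae a α 0), ae_restrict_mem measurableSet_Ioo] with x h1 h2 h3 h4
    rw [h2, Pi.smul_apply, h3, phiFun_zero, smul_eq_mul]
    have h5 := hA x (Set.Ioo_subset_Icc_self h4)
    have h6 : Complex.exp (Complex.I * α * ((-x : ℝ) + a)) =
        Complex.exp (Complex.I * α * a) * (Complex.exp (Complex.I * α * (x + 0)))⁻¹ := by
      rw [← Complex.exp_neg, ← Complex.exp_add]
      congr 1
      push_cast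
      ring
    have h7 := Complex.exp_ne_zero (Complex.I * α * (x + 0))
    have h8 := Complex.exp_ne_zero (Complex.I * α * a)
    rw [h6]
    simp only [B]
    rw [← h5, Complex.exp_neg]
    push_cast
    field_simp
    linear_combination h1
  have h0 := hf 0
  rw [hB, inner_smul_right, inner_phi_parity_phi_self ha hα] at h0
  have hB0 := (mul_eq_zero.1 h0).resolve_right
    (by exact_mod_cast overlap_ne_zero ha hα hα' 0)
  rw [hB, hB0, zero_smul]

theorem eq_zero_of_inner_parity_phi (ha : 0 < a) (hα : 0 < α) (hα' : α < Real.pi / (2 * a))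
    {f : L2 a} (hf : ∀ n, inner ℂ (parity a (phi a α n)) f = 0) : f = 0 := by
  have := eq_zero_of_inner_phi ha hα hα' (f := parity a f) fun n => by
    rw [← inner_parity_left, hf]
  rw [← parity_parity f, this, map_zero]

theorem topologicalClosure_span_parity_phi (ha : 0 < a) (hα : 0 < α)
    (hα' : α < Real.pi / (2 * a)) :
    (Submodule.span ℂ (Set.range fun n => parity a (phi a α n))).topologicalClosure = ⊤ := by
  rw [Submodule.topologicalClosure_eq_top_iff, Submodule.eq_bot_iff]
  intro f hf
  refine eq_zero_of_inner_parity_phi ha hα hα' fun n => ?_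
  exact (Submodule.mem_orthogonal _ f).1 hf _ (Submodule.subset_span ⟨n, rfl⟩)

theorem ext_on_parity_phi (ha : 0 < a) (hα : 0 < α) (hα' : α < Real.pi / (2 * a))
    {S T : L2 a →L[ℂ] L2 a} (h : ∀ n, S (parity a (phi a α n)) = T (parity a (phi a α n))) :
    S = T := by
  refine ContinuousLinearMap.ext_on (s := Set.range fun n => parity a (phi a α n)) ?_ ?_
  · exact Submodule.dense_iff_topologicalClosure_eq_top.2
      (topologicalClosure_span_parity_phi ha hα hα')
  · rintro _ ⟨n, rfl⟩
    exact h n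

end Eigenfunctions

/-! ### The adjoint of the Robin Laplacian -/

section Adjoint

variable {a α : ℝ}

theorem dense_domain_robin (ha : 0 < a) (hα : 0 < α) (hα' : α < Real.pi / (2 * a)) :
    Dense ((robin a (Complex.I * α) (Complex.I * α)).domain : Set (L2 a)) := by
  refine (Submodule.dense_iff_topologicalClosure_eq_top.2
    (topologicalClosure_span_parity_phi ha hα hα')).mono ?_
  refine Submodule.span_le.2 ?_
  rintro _ ⟨n, rfl⟩
  have := parity_phi_mem_robinGraph ha α n
  rw [← robin_graph] at this
  exact LinearPMap.mem_domain_of_mem_graph this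

/-- Green's formula gives one inclusion. Conversely, if `H* ψ = f`, surjectivity provides `η` with
the same image `f` in the `-iα` operator; then `ψ - η` is orthogonal to the range of `H`, which is
the whole space. -/
theorem adjoint_graph_robin (ha : 0 < a) (hα : 0 < α) (hα' : α < Real.pi / (2 * a)) :
    (robin a (Complex.I * α) (Complex.I * α)).adjoint.graph =
      robinGraph a (-(Complex.I * α)) (-(Complex.I * α)) := by
  have hc : (starRingEnd ℂ) (Complex.I * α) = -(Complex.I * α) := by simp
  have hne : Complex.I * (α : ℂ) ≠ 0 :=
    mul_ne_zero Complex.I_ne_zero (by exact_mod_cast hα.ne')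
  rw [LinearPMap.adjoint_graph_eq_graph_adjoint (dense_domain_robin ha hα hα'), robin_graph]
  ext ⟨ψ, f⟩
  rw [Submodule.mem_adjoint_iff]
  constructor
  · intro h
    obtain ⟨η, hη⟩ := exists_mem_robinGraph ha (neg_ne_zero.2 hne) f
    have hker : ψ - η = 0 := by
      refine ext_inner_left ℂ fun g => ?_
      obtain ⟨ξ, hξ⟩ := exists_mem_robinGraph ha hne g
      have h1 := h ξ g hξ
      have h2 := inner_robinGraph ha hξ (by rw [hc]; exact hη)
      have h3 := congrArg (starRingEnd ℂ) h2
      rw [inner_conj_symm, inner_conj_symm] at h3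
      rw [inner_sub_right, inner_zero_right, h3]
      exact h1
    rw [sub_eq_zero.1 hker]
    exact hη
  · intro h ξ g hξ
    have h2 := inner_robinGraph ha hξ (by rw [hc]; exact h)
    have h3 := congrArg (starRingEnd ℂ) h2
    rw [inner_conj_symm, inner_conj_symm] at h3
    rw [h3, sub_self]

theorem isSelfAdjointWrt_parity (ha : 0 < a) (hα : 0 < α) (hα' : α < Real.pi / (2 * a)) :
    IsSelfAdjointWrt (robin a (Complex.I * α) (Complex.I * α)) (parity a) := by
  refine ⟨isUnit_parity a, fun ψ f => ?_⟩
  rw [adjoint_graph_robin ha hα hα', robin_graph, parity_mem_robinGraph_iff ha]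

theorem isClosed_robinGraph (ha : 0 < a) (hα : 0 < α) (hα' : α < Real.pi / (2 * a)) :
    IsClosed (robinGraph a (-(Complex.I * α)) (-(Complex.I * α)) : Set (L2 a × L2 a)) := by
  rw [← adjoint_graph_robin ha hα hα']
  exact LinearPMap.adjoint_isClosed (dense_domain_robin ha hα hα')

end Adjoint

/-! ### Strong convergence of the series -/

section Series

variable {a α : ℝ}

theorem continuous_chiN (a : ℝ) (n : ℕ) : Continuous (chiN a n) := by
  unfold chiN
  split_ifs <;> fun_prop

theorem continuous_chiD (a : ℝ) (n : ℕ) : Continuous (chiD a n) := by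
  unfold chiD
  fun_prop

theorem memLp_ofReal_of_continuous {k : ℝ → ℝ} (hk : Continuous k) (a : ℝ) :
    MemLp (fun x => (k x : ℂ)) 2 (vol a) :=
  ContinuousOn.memLp_vol (Complex.continuous_ofReal.comp hk).continuousOn

/-- The Neumann eigenfunctions with positive eigenvalues, as elements of `L²(-a,a)`. -/
def neumann (a : ℝ) (n : ℕ) : L2 a :=
  (memLp_ofReal_of_continuous (continuous_chiN a (n + 1)) a).toLp

/-- The Dirichlet eigenfunctions as elements of `L²(-a,a)`. -/
def dirichlet (a : ℝ) (n : ℕ) : L2 a :=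
  (memLp_ofReal_of_continuous (continuous_chiD a (n + 1)) a).toLp

theorem integrable_cos_mul_angle (a : ℝ) (m : ℤ) :
    Integrable (fun x => ((Real.cos (m * angle a x) : ℝ) : ℂ)) (vol a) := by
  have := continuous_angle a
  exact ContinuousOn.integrable_vol (by fun_prop)

theorem orthonormal_neumann (ha : 0 < a) : Orthonormal ℂ (neumann a) := by
  have ha' : (a : ℂ) ≠ 0 := by exact_mod_cast ha.ne'
  rw [orthonormal_iff_ite]
  intro m n
  unfold neumann
  rw [inner_eq_integral (MemLp.coeFn_toLp _) (MemLp.coeFn_toLp _)]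
  have e : ∀ x, (starRingEnd ℂ) ((chiN a (m + 1) x : ℝ) : ℂ) * ((chiN a (n + 1) x : ℝ) : ℂ) =
      1 / (2 * a) * (((Real.cos ((m - n : ℤ) * angle a x) : ℝ) : ℂ) +
        ((Real.cos ((m + n + 2 : ℤ) * angle a x) : ℝ) : ℂ)) := by
    intro x
    have e1 : ((m - n : ℤ) : ℝ) * angle a x =
        ((m + 1 : ℕ) : ℝ) * angle a x - ((n + 1 : ℕ) : ℝ) * angle a x := by push_cast; ring
    have e2 : ((m + n + 2 : ℤ) : ℝ) * angle a x =
        ((m + 1 : ℕ) : ℝ) * angle a x + ((n + 1 : ℕ) : ℝ) * angle a x := by push_cast; ring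
    rw [e1, e2, Real.cos_sub, Real.cos_add, Complex.conj_ofReal]
    simp only [chiN, Nat.add_eq_zero_iff, one_ne_zero, and_false, if_false, kn_mul,
      Complex.ofReal_mul, Complex.ofReal_add, Complex.ofReal_sub]
    rw [mul_mul_mul_comm, sqrt_mul_sqrt ha]
    field_simp
    ring
  simp_rw [e]
  rw [integral_const_mul, integral_add (integrable_cos_mul_angle a _)
    (integrable_cos_mul_angle a _), integral_cos_mul_angle ha, integral_cos_mul_angle ha,
    if_neg (by omega : (m + n + 2 : ℤ) ≠ 0)]
  by_cases h : m = n
  · rw [if_pos (by omega), if_pos h]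
    field_simp
    ring
  · rw [if_neg (by omega), if_neg h]
    simp

theorem orthonormal_dirichlet (ha : 0 < a) : Orthonormal ℂ (dirichlet a) := by
  have ha' : (a : ℂ) ≠ 0 := by exact_mod_cast ha.ne'
  rw [orthonormal_iff_ite]
  intro m n
  unfold dirichlet
  rw [inner_eq_integral (MemLp.coeFn_toLp _) (MemLp.coeFn_toLp _)]
  have e : ∀ x, (starRingEnd ℂ) ((chiD a (m + 1) x : ℝ) : ℂ) * ((chiD a (n + 1) x : ℝ) : ℂ) =
      1 / (2 * a) * (((Real.cos ((m - n : ℤ) * angle a x) : ℝ) : ℂ) -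
        ((Real.cos ((m + n + 2 : ℤ) * angle a x) : ℝ) : ℂ)) := by
    intro x
    have e1 : ((m - n : ℤ) : ℝ) * angle a x =
        ((m + 1 : ℕ) : ℝ) * angle a x - ((n + 1 : ℕ) : ℝ) * angle a x := by push_cast; ring
    have e2 : ((m + n + 2 : ℤ) : ℝ) * angle a x =
        ((m + 1 : ℕ) : ℝ) * angle a x + ((n + 1 : ℕ) : ℝ) * angle a x := by push_cast; ring
    rw [e1, e2, Real.cos_sub, Real.cos_add, Complex.conj_ofReal]
    simp only [chiD, kn_mul, Complex.ofReal_mul, Complex.ofReal_add, Complex.ofReal_sub]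
    rw [mul_mul_mul_comm, sqrt_mul_sqrt ha]
    field_simp
    ring
  simp_rw [e]
  rw [integral_const_mul, integral_sub (integrable_cos_mul_angle a _)
    (integrable_cos_mul_angle a _), integral_cos_mul_angle ha, integral_cos_mul_angle ha,
    if_neg (by omega : (m + n + 2 : ℤ) ≠ 0)]
  by_cases h : m = n
  · rw [if_pos (by omega), if_pos h]
    field_simp
    ring
  · rw [if_neg (by omega), if_neg h]
    simp

theorem phi_succ (a α : ℝ) (n : ℕ) : phi a α (n + 1) =
    neumann a n + (Complex.I * (α / kn a (n + 1) : ℝ)) • dirichlet a n := by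
  refine Lp.ext ?_
  filter_upwards [phi_ae a α (n + 1), Lp.coeFn_add (neumann a n)
    ((Complex.I * (α / kn a (n + 1) : ℝ)) • dirichlet a n),
    Lp.coeFn_smul (Complex.I * (α / kn a (n + 1) : ℝ)) (dirichlet a n),
    MemLp.coeFn_toLp (memLp_ofReal_of_continuous (continuous_chiN a (n + 1)) a),
    MemLp.coeFn_toLp (memLp_ofReal_of_continuous (continuous_chiD a (n + 1)) a)]
    with x h1 h2 h3 h4 h5
  rw [h1, h2, Pi.add_apply, h3, Pi.smul_apply, smul_eq_mul]
  unfold neumann dirichlet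
  rw [h4, h5]
  simp [phiFun]

theorem _root_.Orthonormal.summable_smul {E : Type*} [NormedAddCommGroup E]
    [InnerProductSpace ℂ E] [CompleteSpace E] {v : ℕ → E} (hv : Orthonormal ℂ v) {c : ℕ → ℂ}
    (hc : Summable fun n => ‖c n‖ ^ 2) : Summable fun n => c n • v n := by
  have := (hv.orthogonalFamily.summable_iff_norm_sq_summable c).2 hc
  simpa only [LinearIsometry.toSpanSingleton_apply] using this

theorem norm_I_mul_le (ha : 0 < a) (hα : 0 < α) (hα' : α < Real.pi / (2 * a)) (n : ℕ) :
    ‖Complex.I * ((α / kn a (n + 1) : ℝ) : ℂ)‖ ≤ 1 := by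
  have hk := kn_pos ha n.succ_ne_zero
  rw [norm_mul, Complex.norm_I, one_mul, Complex.norm_real, Real.norm_of_nonneg (by positivity),
    div_le_one hk]
  exact (lt_kn ha hα' n.succ_ne_zero).le

/-- Bessel's inequality for the Neumann and Dirichlet families, using `|α/k_n| ≤ 1`. -/
theorem summable_norm_inner_phi (ha : 0 < a) (hα : 0 < α) (hα' : α < Real.pi / (2 * a))
    (f : L2 a) : Summable fun n => ‖inner ℂ (phi a α (n + 1)) f‖ ^ 2 := by
  have h1 := (orthonormal_neumann ha).inner_products_summable f
  have h2 := (orthonormal_dirichlet ha).inner_products_summable f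
  refine Summable.of_nonneg_of_le (fun n => by positivity) (fun n => ?_)
    ((h1.add h2).mul_left 2)
  rw [phi_succ, inner_add_left, inner_smul_left]
  have h3 := norm_add_le (inner ℂ (neumann a n) f)
    ((starRingEnd ℂ) (Complex.I * ((α / kn a (n + 1) : ℝ) : ℂ)) * inner ℂ (dirichlet a n) f)
  rw [norm_mul, RCLike.norm_conj] at h3
  have h4 : ‖Complex.I * ((α / kn a (n + 1) : ℝ) : ℂ)‖ * ‖inner ℂ (dirichlet a n) f‖ ≤
      1 * ‖inner ℂ (dirichlet a n) f‖ :=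
    mul_le_mul_of_nonneg_right (norm_I_mul_le ha hα hα' n) (norm_nonneg _)
  rw [one_mul] at h4
  refine (pow_le_pow_left₀ (norm_nonneg _) (h3.trans (add_le_add_right h4 _)) 2).trans ?_
  nlinarith [sq_nonneg (‖inner ℂ (neumann a n) f‖ - ‖inner ℂ (dirichlet a n) f‖)]

theorem summable_theta (ha : 0 < a) (hα : 0 < α) (hα' : α < Real.pi / (2 * a)) {C : ℕ → ℝ}
    (hC : IsAdmissible C) (f : L2 a) :
    Summable fun n => (((C n ^ 2 : ℝ) : ℂ) * inner ℂ (phi a α n) f) • phi a α n := by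
  obtain ⟨m₁, m₂, hm, hCm⟩ := hC
  -- The term with `φ_0` is set aside, because only for `n ≥ 1` does `φ_n` split into a Neumann and
  -- a Dirichlet part.
  rw [← summable_nat_add_iff 1]
  let c : ℕ → ℂ := fun n => ((C (n + 1) ^ 2 : ℝ) : ℂ) * inner ℂ (phi a α (n + 1)) f
  have hc : Summable fun n => ‖c n‖ ^ 2 := by
    refine Summable.of_nonneg_of_le (fun n => by positivity) (fun n => ?_)
      ((summable_norm_inner_phi ha hα hα' f).mul_left ((m₂ ^ 2) ^ 2))
    rw [norm_mul, mul_pow, Complex.norm_real, Real.norm_of_nonneg (by positivity)]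
    have h1 := (hm.trans (hCm (n + 1)).1).le
    have h2 := (hCm (n + 1)).2.le
    gcongr
  have hd : Summable fun n => ‖c n * (Complex.I * ((α / kn a (n + 1) : ℝ) : ℂ))‖ ^ 2 := by
    refine Summable.of_nonneg_of_le (fun n => by positivity) (fun n => ?_) hc
    rw [norm_mul]
    exact pow_le_pow_left₀ (by positivity)
      (mul_le_of_le_one_right (norm_nonneg _) (norm_I_mul_le ha hα hα' n)) 2
  refine (((orthonormal_neumann ha).summable_smul hc).add
    ((orthonormal_dirichlet ha).summable_smul hd)).congr fun n => ?_
  rw [mul_smul (c n), ← smul_add, ← phi_succ]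

/-- Boundedness of the pointwise limit of the partial sums is the uniform boundedness principle,
contained in `continuousLinearMapOfTendsto`. -/
theorem exists_isTheta (ha : 0 < a) (hα : 0 < α) (hα' : α < Real.pi / (2 * a)) {C : ℕ → ℝ}
    (hC : IsAdmissible C) : ∃ Θ : L2 a →L[ℂ] L2 a, IsTheta a α C Θ := by
  let g : ℕ → L2 a →L[ℂ] L2 a := fun N => ∑ n ∈ Finset.range N,
    ((C n ^ 2 : ℝ) : ℂ) • (innerSL ℂ (phi a α n)).smulRight (phi a α n)
  let θ : L2 a → L2 a := fun f =>
    ∑' n, (((C n ^ 2 : ℝ) : ℂ) * inner ℂ (phi a α n) f) • phi a α n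
  have hg : ∀ N f, g N f = ∑ n ∈ Finset.range N,
      (((C n ^ 2 : ℝ) : ℂ) * inner ℂ (phi a α n) f) • phi a α n := by
    intro N f
    simp only [g, sum_apply]
    refine Finset.sum_congr rfl fun n _ => ?_
    simp [mul_smul]
  have hθ : ∀ f, Filter.Tendsto (fun N : ℕ => ∑ n ∈ Finset.range N,
      (((C n ^ 2 : ℝ) : ℂ) * inner ℂ (phi a α n) f) • phi a α n) Filter.atTop (nhds (θ f)) :=
    fun f => (summable_theta ha hα hα' hC f).hasSum.tendsto_sum_nat
  have h : Filter.Tendsto (fun N f => g N f) Filter.atTop (nhds θ) :=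
    tendsto_pi_nhds.2 fun f => by simpa only [hg] using hθ f
  exact ⟨continuousLinearMapOfTendsto g h, hθ⟩

end Series

/-! ### Properties of `Θ` -/

section Theta

variable {a α : ℝ} {C : ℕ → ℝ} {Θ : L2 a →L[ℂ] L2 a}

/-- By biorthogonality every partial sum beyond index `n` reduces to its `n`-th term. -/
theorem IsTheta.apply_parity_phi (ha : 0 < a) (hα : 0 < α) (hα' : α < Real.pi / (2 * a))
    (h : IsTheta a α C Θ) (n : ℕ) :
    Θ (parity a (phi a α n)) = ((C n ^ 2 * overlap a α n : ℝ) : ℂ) • phi a α n := by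
  refine tendsto_nhds_unique (h (parity a (phi a α n))) (tendsto_const_nhds.congr' ?_)
  filter_upwards [Filter.eventually_gt_atTop n] with N hN
  rw [Finset.sum_eq_single n]
  · rw [inner_phi_parity_phi ha hα hα', if_pos rfl]
    push_cast
    rfl
  · intro m _ hm
    rw [inner_phi_parity_phi ha hα hα', if_neg hm, mul_zero, zero_smul]
  · intro hn
    exact absurd (Finset.mem_range.2 hN) hn

/-- Each partial sum sends `(ψ, f)` into the span of the eigenpairs of `H*`, because `⟨φ_n, f⟩ = λ_n
⟨φ_n, ψ⟩`; closedness of the graph passes to the limit. -/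
theorem IsTheta.mem_robinGraph (ha : 0 < a) (hα : 0 < α) (hα' : α < Real.pi / (2 * a))
    (h : IsTheta a α C Θ) {ψ f : L2 a} (hψ : (ψ, f) ∈ robinGraph a (Complex.I * α) (Complex.I * α)) :
    (Θ ψ, Θ f) ∈ robinGraph a (-(Complex.I * α)) (-(Complex.I * α)) := by
  refine (isClosed_robinGraph ha hα hα').mem_of_tendsto ((h ψ).prodMk_nhds (h f))
    (Filter.Eventually.of_forall fun N => ?_)
  have hsum : (∑ n ∈ Finset.range N, (((C n ^ 2 : ℝ) : ℂ) * inner ℂ (phi a α n) ψ) • phi a α n,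
      ∑ n ∈ Finset.range N, (((C n ^ 2 : ℝ) : ℂ) * inner ℂ (phi a α n) f) • phi a α n) =
      ∑ n ∈ Finset.range N, ((((C n ^ 2 : ℝ) : ℂ) * inner ℂ (phi a α n) ψ) • phi a α n,
        (((C n ^ 2 : ℝ) : ℂ) * inner ℂ (phi a α n) f) • phi a α n) := by
    rw [Prod.ext_iff, Prod.fst_sum, Prod.snd_sum]
    exact ⟨rfl, rfl⟩
  rw [hsum]
  refine Submodule.sum_mem _ fun n _ => ?_
  have := Submodule.smul_mem _ (((C n ^ 2 : ℝ) : ℂ) * inner ℂ (phi a α n) ψ)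
    (phi_mem_robinGraph ha α n)
  rw [inner_phi_robinGraph ha n hψ]
  convert! this using 2
  rw [Prod.smul_snd, smul_smul]
  congr 1
  ring

/-- `⟨f, Θ f⟩ = ∑ C_n² |⟨φ_n, f⟩|²`, and by completeness some term is positive. -/
theorem IsTheta.inner_pos (ha : 0 < a) (hα : 0 < α) (hα' : α < Real.pi / (2 * a))
    (hC : IsAdmissible C) (h : IsTheta a α C Θ) {f : L2 a} (hf : f ≠ 0) :
    (inner ℂ f (Θ f)).im = 0 ∧ 0 < (inner ℂ f (Θ f)).re := by
  obtain ⟨m₁, m₂, hm, hCm⟩ := hC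
  have hlim : Filter.Tendsto (fun N : ℕ => ((∑ n ∈ Finset.range N,
      C n ^ 2 * ‖inner ℂ (phi a α n) f‖ ^ 2 : ℝ) : ℂ)) Filter.atTop
      (nhds (inner ℂ f (Θ f))) := by
    refine (((innerSL ℂ f).continuous.tendsto _).comp (h f)).congr fun N => ?_
    simp only [Function.comp_apply, innerSL_apply_apply, inner_sum, inner_smul_right]
    push_cast
    refine Finset.sum_congr rfl fun n _ => ?_
    rw [← inner_conj_symm f, mul_assoc, Complex.mul_conj, Complex.normSq_eq_norm_sq]
    push_cast
    rfl
  have hre := (Complex.continuous_re.tendsto _).comp hlim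
  have him := (Complex.continuous_im.tendsto _).comp hlim
  refine ⟨tendsto_nhds_unique him (tendsto_const_nhds.congr fun N => ?_), ?_⟩
  · rw [Function.comp_apply, Complex.ofReal_im]
  · obtain ⟨n, hn⟩ : ∃ n, inner ℂ (phi a α n) f ≠ 0 := by
      by_contra! hall
      exact hf (eq_zero_of_inner_phi ha hα hα' hall)
    have hpos : 0 < C n ^ 2 * ‖inner ℂ (phi a α n) f‖ ^ 2 := by
      have := hm.trans (hCm n).1
      have := norm_pos_iff.2 hn
      positivity
    refine hpos.trans_le (ge_of_tendsto hre ?_)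
    filter_upwards [Filter.eventually_gt_atTop n] with N hN
    rw [Function.comp_apply, Complex.ofReal_re]
    exact Finset.single_le_sum (f := fun n => C n ^ 2 * ‖inner ℂ (phi a α n) f‖ ^ 2)
      (fun i _ => by positivity) (Finset.mem_range.2 hN)

/-- This is the origin of the prescribed squares: they normalise `C_n² ⟨φ_n, P φ_n⟩` to modulus one.
-/
theorem choiceSq_eq (ha : 0 < a) (α : ℝ) (n : ℕ) :
    choiceSq a α n = |overlap a α n|⁻¹ := by
  by_cases hn : n = 0
  · subst hn
    simp only [choiceSq, overlap, if_true]
    rw [abs_div, inv_div, abs_mul, abs_mul, abs_of_pos ha, abs_two]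
  · have hk := kn_pos ha hn
    simp only [choiceSq, overlap, if_neg hn]
    rw [abs_mul, abs_pow, abs_neg, abs_one, one_pow, one_mul]
    have : 1 - α ^ 2 / kn a n ^ 2 = (kn a n ^ 2 - α ^ 2) / kn a n ^ 2 := by
      field_simp
    rw [this, abs_div, inv_div, abs_of_pos (pow_pos hk 2)]

theorem IsTheta.sq_eq_one_iff (ha : 0 < a) (hα : 0 < α) (hα' : α < Real.pi / (2 * a))
    (h : IsTheta a α C Θ) :
    (parity a * Θ) ^ 2 = 1 ↔ ∀ n, C n ^ 2 = choiceSq a α n := by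
  have key : ∀ n, ((parity a * Θ) ^ 2) (parity a (phi a α n)) =
      (((C n ^ 2 * overlap a α n) ^ 2 : ℝ) : ℂ) • parity a (phi a α n) := by
    intro n
    rw [pow_two, mul_apply_eq_comp, mul_apply_eq_comp,
      mul_apply_eq_comp, h.apply_parity_phi ha hα hα', map_smul, map_smul, map_smul,
      h.apply_parity_phi ha hα hα', map_smul, smul_smul]
    congr 1
    push_cast
    ring
  have hiff : ∀ n, (C n ^ 2 * overlap a α n) ^ 2 = 1 ↔ C n ^ 2 = choiceSq a α n := by
    intro n
    have h0 := abs_pos.2 (overlap_ne_zero ha hα hα' n)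
    rw [choiceSq_eq ha α, ← mul_eq_one_iff_eq_inv₀ h0.ne', ← sq_abs, abs_mul,
      abs_of_nonneg (sq_nonneg (C n)),
      pow_eq_one_iff_of_nonneg (by positivity) two_ne_zero]
  have hne : ∀ n, parity a (phi a α n) ≠ 0 := fun n h0 =>
    phi_ne_zero ha hα hα' n (by rw [← parity_parity (phi a α n), h0, map_zero])
  constructor
  · intro h1 n
    have h2 := key n
    rw [h1, one_apply_eq_self] at h2
    have h3 : ((((C n ^ 2 * overlap a α n) ^ 2 : ℝ) : ℂ) - 1) • parity a (phi a α n) = 0 := by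
      rw [sub_smul, ← h2, one_smul, sub_self]
    have h4 := sub_eq_zero.1 ((smul_eq_zero.1 h3).resolve_right (hne n))
    exact (hiff n).1 (by exact_mod_cast h4)
  · intro h1
    refine ext_on_parity_phi ha hα hα' fun n => ?_
    rw [key, (hiff n).2 (h1 n), Complex.ofReal_one, one_smul, one_apply_eq_self]

theorem IsTheta.isMetricOperator (ha : 0 < a) (hα : 0 < α) (hα' : α < Real.pi / (2 * a))
    (hC : IsAdmissible C) (h : IsTheta a α C Θ) (hsq : (parity a * Θ) ^ 2 = 1) :
    IsMetricOperator (robin a (Complex.I * α) (Complex.I * α)) Θ := by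
  have hP := parity_mul_self a
  have hPΘ : ∀ f, parity a (Θ (parity a (Θ f))) = f := fun f => by
    have := DFunLike.congr_fun hsq f
    rwa [pow_two] at this
  refine ⟨fun f hf => h.inner_pos ha hα hα' hC hf,
    -- Since `P Θ P Θ = I` and `P² = I`, the inverse of `Θ` is `P Θ P`.
    ⟨⟨Θ, parity a * Θ * parity a, ?_, ?_⟩, rfl⟩, fun ψ f => ?_⟩
  · refine ContinuousLinearMap.ext fun f => ?_
    change Θ (parity a (Θ (parity a f))) = f
    rw [← parity_parity (Θ (parity a (Θ (parity a f)))), hPΘ, parity_parity]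
  · exact ContinuousLinearMap.ext hPΘ
  · rw [adjoint_graph_robin ha hα hα', robin_graph]
    refine ⟨h.mem_robinGraph ha hα hα', fun hψ => ?_⟩
    -- Reflection brings `(Θ ψ, Θ f)` back into the graph of `H`. A further application of `P Θ`
    -- stays in that graph and returns `(ψ, f)`.
    have h1 := parity_mem_robinGraph ha hψ
    rw [neg_neg] at h1
    have h2 := parity_mem_robinGraph ha (h.mem_robinGraph ha hα hα' h1)
    rwa [neg_neg, hPΘ, hPΘ] at h2

theorem IsTheta.isCOperator (ha : 0 < a) (hα : 0 < α) (hα' : α < Real.pi / (2 * a))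
    (hC : IsAdmissible C) (h : IsTheta a α C Θ) (hsq : (parity a * Θ) ^ 2 = 1) :
    IsCOperator (parity a) (robin a (Complex.I * α) (Complex.I * α)) (parity a * Θ) := by
  refine ⟨isSelfAdjointWrt_parity ha hα hα', fun ψ f hψ => ?_, by rw [← pow_two, hsq], ?_⟩
  · rw [robin_graph] at hψ ⊢
    have := parity_mem_robinGraph ha (h.mem_robinGraph ha hα hα' hψ)
    rwa [neg_neg] at this
  · rw [← mul_assoc, parity_mul_self, one_mul]
    exact h.isMetricOperator ha hα hα' hC hsq

theorem exists_isAdmissible (ha : 0 < a) (hα : 0 < α) (hα' : α < Real.pi / (2 * a)) :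
    ∃ C : ℕ → ℝ, IsAdmissible C ∧ ∀ n, C n ^ 2 = choiceSq a α n := by
  have hpos : ∀ n, 0 < choiceSq a α n := fun n => by
    rw [choiceSq_eq ha α]
    exact inv_pos.2 (abs_pos.2 (overlap_ne_zero ha hα hα' n))
  have hov : ∀ n, n ≠ 0 → |overlap a α n| = 1 - α ^ 2 / kn a n ^ 2 := fun n hn => by
    simp only [overlap, if_neg hn]
    rw [abs_mul, abs_pow, abs_neg, abs_one, one_pow, one_mul,
      abs_of_pos (one_sub_pos ha hα hα' hn)]
  have hlow : ∀ n, min 1 (choiceSq a α 0) ≤ choiceSq a α n := fun n => by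
    by_cases hn : n = 0
    · rw [hn]
      exact min_le_right _ _
    · refine (min_le_left _ _).trans ?_
      rw [choiceSq_eq ha α, hov n hn]
      refine (one_le_inv₀ (one_sub_pos ha hα hα' hn)).2 ?_
      rw [sub_le_self_iff]
      positivity
  have hup : ∀ n, choiceSq a α n ≤ max (choiceSq a α 0) (choiceSq a α 1) := fun n => by
    by_cases hn : n = 0
    · rw [hn]
      exact le_max_left _ _
    · refine le_trans ?_ (le_max_right _ _)
      rw [choiceSq_eq ha α, choiceSq_eq ha α, hov n hn, hov 1 one_ne_zero]
      have h1 := kn_pos ha one_ne_zero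
      have h2 := (kn_strictMono ha).monotone (Nat.one_le_iff_ne_zero.2 hn)
      have := one_sub_pos ha hα hα' one_ne_zero
      gcongr
  have hmin : 0 < min 1 (choiceSq a α 0) := lt_min one_pos (hpos 0)
  -- For `n ≥ 1` the squares exceed `1` and are at most the one at `n = 1`; the index `0` is bounded
  -- separately. Halving and adding `1` make the bounds strict.
  refine ⟨fun n => √(choiceSq a α n), ⟨√(min 1 (choiceSq a α 0)) / 2,
    √(max (choiceSq a α 0) (choiceSq a α 1)) + 1, by positivity, fun n => ⟨?_, ?_⟩⟩,
    fun n => Real.sq_sqrt (hpos n).le⟩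
  · exact (half_lt_self (Real.sqrt_pos.2 hmin)).trans_le (Real.sqrt_le_sqrt (hlow n))
  · exact (Real.sqrt_le_sqrt (hup n)).trans_lt (lt_add_one _)

end Theta

/-! ### Integral operators with bounded kernels -/

section Kernel

variable {a α : ℝ}

/-- Each row of a bounded kernel lies in `L²` of the finite interval, so the integral is an inner
product; this gives linearity and, by Cauchy–Schwarz, a bound uniform in `x`. -/
theorem exists_isIntegralOperator (a : ℝ) {k : ℝ → ℝ → ℂ} {B : ℝ}
    (hk : Measurable (Function.uncurry k)) (hB : ∀ x y, ‖k x y‖ ≤ B) :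
    ∃ T : L2 a →L[ℂ] L2 a, IsIntegralOperator a k T := by
  have hB0 : 0 ≤ B := (norm_nonneg _).trans (hB 0 0)
  have hkx : ∀ x, Measurable (k x) := fun x => hk.comp measurable_prodMk_left
  have hkL : ∀ x, MemLp (fun y => (starRingEnd ℂ) (k x y)) 2 (vol a) := fun x =>
    MemLp.of_bound (Complex.continuous_conj.measurable.comp (hkx x)).aestronglyMeasurable B
      (Filter.Eventually.of_forall fun y => by rw [RCLike.norm_conj]; exact hB x y)
  let M : ℝ := (measureUnivNNReal (vol a) : ℝ) ^ ((2 : ENNReal).toReal⁻¹)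
  have hM : 0 ≤ M := by positivity
  have hinner : ∀ (f : L2 a) (x : ℝ), ∫ y, k x y * f y ∂(vol a) = inner ℂ (hkL x).toLp f := by
    intro f x
    rw [inner_eq_integral (hkL x).coeFn_toLp (Filter.EventuallyEq.refl _ _)]
    simp
  have hbound : ∀ (f : L2 a) (x : ℝ), ‖∫ y, k x y * f y ∂(vol a)‖ ≤ M * B * ‖f‖ := by
    intro f x
    rw [hinner]
    refine (norm_inner_le_norm _ _).trans (mul_le_mul_of_nonneg_right ?_ (norm_nonneg f))
    refine Lp.norm_le_of_ae_bound hB0 ?_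
    filter_upwards [(hkL x).coeFn_toLp] with y hy
    rw [hy, RCLike.norm_conj]
    exact hB x y
  have hmeas : ∀ f : L2 a, StronglyMeasurable fun x => ∫ y, k x y * f y ∂(vol a) := by
    intro f
    refine StronglyMeasurable.integral_prod_right ?_
    exact hk.stronglyMeasurable.mul
      ((Lp.stronglyMeasurable f).comp_measurable measurable_snd)
  have hLp : ∀ f : L2 a, MemLp (fun x => ∫ y, k x y * f y ∂(vol a)) 2 (vol a) := fun f =>
    MemLp.of_bound (hmeas f).aestronglyMeasurable _ (Filter.Eventually.of_forall (hbound f))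
  let T : L2 a →ₗ[ℂ] L2 a :=
    { toFun := fun f => (hLp f).toLp
      map_add' := fun f g => by
        rw [← MemLp.toLp_add]
        refine MemLp.toLp_congr _ _ (Filter.Eventually.of_forall fun x => ?_)
        simp only [Pi.add_apply, hinner, inner_add_right]
      map_smul' := fun c f => by
        rw [RingHom.id_apply, ← MemLp.toLp_const_smul]
        refine MemLp.toLp_congr _ _ (Filter.Eventually.of_forall fun x => ?_)
        simp only [Pi.smul_apply, hinner, inner_smul_right, smul_eq_mul] }
  refine ⟨T.mkContinuous (M * (M * B)) fun f => ?_, ?_, fun f => (hLp f).coeFn_toLp⟩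
  · rw [mul_assoc]
    refine Lp.norm_le_of_ae_bound (by positivity) ?_
    filter_upwards [(hLp f).coeFn_toLp] with x hx
    exact (congrArg norm hx).le.trans (hbound f x)
  · exact MemLp.of_bound hk.aestronglyMeasurable B
      (Filter.Eventually.of_forall fun p => hB p.1 p.2)

/-! ### The two kernels and their action on the reflected eigenfunctions -/

theorem measurable_sign : Measurable Real.sign := by
  unfold Real.sign
  exact Measurable.ite measurableSet_Iio measurable_const
    (Measurable.ite measurableSet_Ioi measurable_const measurable_const)

theorem abs_sign_le_one (x : ℝ) : |Real.sign x| ≤ 1 := by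
  rcases Real.sign_apply_eq x with h | h | h <;> rw [h] <;> simp

theorem exists_isIntegralOperator_kernelK (a α : ℝ) :
    ∃ K : L2 a →L[ℂ] L2 a, IsIntegralOperator a (kernelK a α) K := by
  refine exists_isIntegralOperator a (B := |α| * (|Real.tan (α * a)| + 1)) ?_ fun x y => ?_
  · have h1 : Measurable fun p : ℝ × ℝ => ((Real.sign (p.2 - p.1) : ℝ) : ℂ) :=
      Complex.measurable_ofReal.comp (measurable_sign.comp (by fun_prop))
    have h2 : Measurable fun p : ℝ × ℝ =>
        (α : ℂ) * Complex.exp (-Complex.I * α * (p.2 - p.1)) :=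
      Continuous.measurable (by fun_prop)
    exact h2.mul (measurable_const.sub (measurable_const.mul h1))
  · unfold kernelK
    have h1 : ‖Complex.exp (-Complex.I * α * (y - x))‖ = 1 := by
      have : -Complex.I * α * (y - x) = ((-(α * (y - x)) : ℝ) : ℂ) * Complex.I := by
        push_cast
        ring
      rw [this, Complex.norm_exp_ofReal_mul_I]
    rw [norm_mul, norm_mul, h1, mul_one, Complex.norm_real, Real.norm_eq_abs]
    refine mul_le_mul_of_nonneg_left ((norm_sub_le _ _).trans ?_) (abs_nonneg _)
    rw [norm_mul, Complex.norm_I, one_mul, Complex.norm_real, Complex.norm_real,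
      Real.norm_eq_abs, Real.norm_eq_abs]
    exact add_le_add_right (abs_sign_le_one _) _

theorem kernelL_eq (a α x y : ℝ) : kernelL a α x y = kernelK a α (-x) y := by
  unfold kernelL kernelK
  rw [sub_neg_eq_add]
  push_cast
  rw [sub_neg_eq_add]

theorem IsIntegralOperator.parity_mul {K : L2 a →L[ℂ] L2 a}
    (hK : IsIntegralOperator a (kernelK a α) K) :
    IsIntegralOperator a (kernelL a α) (parity a * K) := by
  constructor
  · have := hK.1.comp_measurePreserving
      ((measurePreserving_neg_vol a).prod (MeasurePreserving.id (vol a)))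
    convert this using 1
    ext p
    exact kernelL_eq a α p.1 p.2
  · intro f
    filter_upwards [parity_ae_of_ae (hK.2 f)] with x hx
    simp_rw [kernelL_eq]
    exact hx

/-- The action of the kernel on a function whose product with `e^{-iαy}` has a primitive `G`. -/
theorem integral_kernelK (ha : 0 < a) {u G : ℝ → ℂ}
    (hG : IsPrimitive a G fun y => Complex.exp (-(Complex.I * α * y)) * u y) {x : ℝ}
    (hx : x ∈ Set.Ioo (-a) a) :
    ∫ y, kernelK a α x y * u y ∂(vol a) = α * Complex.exp (Complex.I * α * x) *
      ((Real.tan (α * a) : ℝ) * (G a - G (-a)) - Complex.I * (G a + G (-a) - 2 * G x)) := by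
  have hxI := Set.Ioo_subset_Icc_self hx
  have haI : a ∈ Set.Icc (-a) a := ⟨by linarith, le_rfl⟩
  have i1 := hG.intervalIntegrable hxI
  have i2 := i1.symm.trans (hG.intervalIntegrable haI)
  have e1 : ∫ y in (-a)..x, Complex.exp (-(Complex.I * α * y)) * u y = G x - G (-a) := by
    rw [hG.2 x hxI]
    ring
  have e2 : ∫ y in x..a, Complex.exp (-(Complex.I * α * y)) * u y = G a - G x := by
    rw [hG.2 a haI, hG.2 x hxI, ← intervalIntegral.integral_add_adjacent_intervals i1 i2]
    ring
  have hexp : ∀ y : ℝ, Complex.exp (-Complex.I * α * (y - x)) =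
      Complex.exp (Complex.I * α * x) * Complex.exp (-(Complex.I * α * y)) := by
    intro y
    rw [← Complex.exp_add]
    congr 1
    ring
  -- The integral is split at `y = x`: the bracket of the kernel is `tan(αa) + i` to the left and
  -- `tan(αa) - i` to the right.
  have f1 : Set.EqOn (fun y : ℝ => α * Complex.exp (Complex.I * α * x) *
      ((Real.tan (α * a) : ℝ) + Complex.I) * (Complex.exp (-(Complex.I * α * y)) * u y))
      (fun y => kernelK a α x y * u y) (Set.uIoo (-a) x) := by
    intro y hy
    rw [Set.uIoo_of_le hxI.1] at hy
    simp only [kernelK, Real.sign_of_neg (sub_neg.2 hy.2), hexp]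
    push_cast
    ring
  have f2 : Set.EqOn (fun y : ℝ => α * Complex.exp (Complex.I * α * x) *
      ((Real.tan (α * a) : ℝ) - Complex.I) * (Complex.exp (-(Complex.I * α * y)) * u y))
      (fun y => kernelK a α x y * u y) (Set.uIoo x a) := by
    intro y hy
    rw [Set.uIoo_of_le hxI.2] at hy
    simp only [kernelK, Real.sign_of_pos (sub_pos.2 hy.1), hexp]
    push_cast
    ring
  have j1 : IntervalIntegrable (fun y => kernelK a α x y * u y) volume (-a) x :=
    (i1.const_mul _).congr_uIoo f1
  have j2 : IntervalIntegrable (fun y => kernelK a α x y * u y) volume x a :=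
    (i2.const_mul _).congr_uIoo f2
  rw [integral_vol ha, ← intervalIntegral.integral_add_adjacent_intervals j1 j2,
    ← intervalIntegral.integral_congr_uIoo f1, ← intervalIntegral.integral_congr_uIoo f2,
    intervalIntegral.integral_const_mul, intervalIntegral.integral_const_mul, e1, e2]
  ring

/-- This identity at `x = αa` is what makes `tan(αa)` the right constant in the kernel: it is needed
for the eigenfunction with index `0`. -/
theorem tan_mul_sin_two (x : ℝ) (hx : Real.cos x ≠ 0) :
    Real.tan x * Real.sin (2 * x) + Real.cos (2 * x) = 1 := by
  rw [Real.tan_eq_sin_div_cos, Real.sin_two_mul, Real.cos_two_mul']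
  field_simp
  linear_combination Real.cos_sq_add_sin_sq x

theorem cos_mul_pos (ha : 0 < a) (hα : 0 < α) (hα' : α < Real.pi / (2 * a)) :
    0 < Real.cos (α * a) := by
  rw [lt_div_iff₀ (by positivity)] at hα'
  have : 0 < α * a := by positivity
  exact Real.cos_pos_of_mem_Ioo ⟨by linarith [Real.pi_pos], by linarith⟩

theorem integral_kernelK_zero (ha : 0 < a) (hα : 0 < α) (hα' : α < Real.pi / (2 * a)) {x : ℝ}
    (hx : x ∈ Set.Ioo (-a) a) :
    ∫ y, kernelK a α x y * phiFun a α 0 (-y) ∂(vol a) = phiFun a α 0 x - phiFun a α 0 (-x) := by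
  have hαc : (α : ℂ) ≠ 0 := by exact_mod_cast hα.ne'
  have hI := Complex.I_ne_zero
  set r : ℂ := ((1 / √(2 * a) : ℝ) : ℂ) with hr
  set ea := Complex.exp (Complex.I * α * a) with hea
  have h := (isPrimitive_exp a (-2 * Complex.I * α) 0).const_mul (r * ea / (-2 * Complex.I * α))
  have hG : IsPrimitive a (fun y => r * ea / (-2 * Complex.I * α) *
      Complex.exp (-2 * Complex.I * α * (y + 0)))
      fun y => Complex.exp (-(Complex.I * α * y)) * phiFun a α 0 (-y) := by
    refine h.congr (Filter.Eventually.of_forall fun y => ?_)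
    have e1 : Complex.exp (-2 * Complex.I * α * (y + 0)) =
        Complex.exp (-(Complex.I * α * y)) * Complex.exp (-(Complex.I * α * y)) := by
      rw [← Complex.exp_add]
      congr 1
      ring
    have e2 : Complex.exp (Complex.I * α * ((-y : ℝ) + a)) =
        Complex.exp (-(Complex.I * α * y)) * ea := by
      rw [hea, ← Complex.exp_add]
      congr 1
      push_cast
      ring
    beta_reduce
    rw [phiFun_zero, e1, e2, ← hr]
    field_simp
  rw [integral_kernelK ha hG hx, phiFun_zero, phiFun_zero, ← hr]
  have htan : ((Real.tan (α * a) : ℝ) : ℂ) * Complex.sin (2 * (α * a)) +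
      Complex.cos (2 * (α * a)) = 1 := by
    exact_mod_cast tan_mul_sin_two (α * a) (cos_mul_pos ha hα hα').ne'
  have p1 : Complex.exp (-2 * Complex.I * α * (a + 0)) =
      Complex.cos (2 * (α * a)) - Complex.sin (2 * (α * a)) * Complex.I := by
    have : -2 * Complex.I * α * (a + 0) = -(2 * (α * a)) * Complex.I := by ring
    rw [this, Complex.exp_mul_I, Complex.cos_neg, Complex.sin_neg]
    ring
  have p2 : Complex.exp (-2 * Complex.I * α * ((-a : ℝ) + 0)) =
      Complex.cos (2 * (α * a)) + Complex.sin (2 * (α * a)) * Complex.I := by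
    have : -2 * Complex.I * α * ((-a : ℝ) + 0) = 2 * (α * a) * Complex.I := by push_cast; ring
    rw [this, Complex.exp_mul_I]
  have hE := Complex.exp_ne_zero (Complex.I * α * x)
  have q1 : Complex.exp (-2 * Complex.I * α * (x + 0)) =
      (Complex.exp (Complex.I * α * x))⁻¹ * (Complex.exp (Complex.I * α * x))⁻¹ := by
    rw [← Complex.exp_neg, ← Complex.exp_add]
    congr 1
    ring
  have q2 : Complex.exp (Complex.I * α * (x + a)) = Complex.exp (Complex.I * α * x) * ea := by
    rw [hea, ← Complex.exp_add]
    congr 1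
    ring
  have q3 : Complex.exp (Complex.I * α * ((-x : ℝ) + a)) =
      (Complex.exp (Complex.I * α * x))⁻¹ * ea := by
    rw [hea, ← Complex.exp_neg, ← Complex.exp_add]
    congr 1
    push_cast
    ring
  rw [p1, p2, q1, q2, q3]
  generalize Complex.exp (Complex.I * α * x) = E at *
  generalize Complex.sin (2 * (α * a)) = s at *
  generalize Complex.cos (2 * (α * a)) = c at *
  -- The antiderivative is a multiple of `e^{-2iαy}`; its endpoint values combine into `tan(αa)
  -- sin(2αa) + cos(2αa) = 1`.
  have step : α * E * ((Real.tan (α * a) : ℝ) * (r * ea / (-2 * Complex.I * α) *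
      (c - s * Complex.I) - r * ea / (-2 * Complex.I * α) * (c + s * Complex.I)) -
      Complex.I * (r * ea / (-2 * Complex.I * α) * (c - s * Complex.I) +
        r * ea / (-2 * Complex.I * α) * (c + s * Complex.I) -
        2 * (r * ea / (-2 * Complex.I * α) * (E⁻¹ * E⁻¹)))) =
      E * r * ea * (((Real.tan (α * a) : ℝ) * s + c) - E⁻¹ * E⁻¹) := by
    field_simp
    ring
  rw [step, htan]
  field_simp

theorem integral_kernelK_of_ne_zero (ha : 0 < a) (α : ℝ) {n : ℕ} (hn : n ≠ 0) {x : ℝ}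
    (hx : x ∈ Set.Ioo (-a) a) :
    ∫ y, kernelK a α x y * phiFun a α n (-y) ∂(vol a) =
      (-1) ^ n * phiFun a α n x - phiFun a α n (-x) := by
  have hk : (kn a n : ℂ) ≠ 0 := by exact_mod_cast (kn_pos ha hn).ne'
  -- The antiderivative `e^{-iαy} sin(nθ)`, up to a factor, vanishes at both endpoints. The tangent
  -- term therefore drops out and only the value at `x` remains.
  have h := (((isPrimitive_exp a (-(Complex.I * α)) 0).mul ha (isPrimitive_sin a n)).const_mul
    ((-1) ^ n * ((1 / √a : ℝ) : ℂ) / kn a n))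
  have hG := h.congr (g' := fun y => Complex.exp (-(Complex.I * α * y)) * phiFun a α n (-y)) (by
    refine (Filter.Eventually.of_forall fun y => ?_)
    beta_reduce
    have e : -(Complex.I * α) * ((y : ℂ) + 0) = -(Complex.I * α * y) := by ring
    rw [phiFun_neg ha α hn, e]
    field_simp
    ring)
  rw [integral_kernelK ha hG hx, phiFun_neg ha α hn, phiFun_of_ne_zero a α hn]
  simp only [angle_right ha, angle_left, mul_zero, Real.sin_zero, Real.sin_nat_mul_pi]
  have e : Complex.exp (-(Complex.I * α) * (x + 0)) = (Complex.exp (Complex.I * α * x))⁻¹ := by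
    rw [← Complex.exp_neg]
    congr 1
    ring
  have hE := Complex.exp_ne_zero (Complex.I * α * x)
  rw [e]
  push_cast
  field_simp
  ring

/-- Both sides send `P φ_n` to `(-1)^n φ_n`, and the `P φ_n` span a dense subspace. -/
theorem IsTheta.eq_one_add (ha : 0 < a) (hα : 0 < α) (hα' : α < Real.pi / (2 * a)) {C : ℕ → ℝ}
    {Θ K : L2 a →L[ℂ] L2 a} (h : IsTheta a α C Θ) (hC : ∀ n, C n ^ 2 = choiceSq a α n)
    (hK : IsIntegralOperator a (kernelK a α) K) : Θ = 1 + K := by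
  refine ext_on_parity_phi ha hα hα' fun n => ?_
  rw [h.apply_parity_phi ha hα hα', add_apply, one_apply_eq_self]
  -- The product is the sign of `⟨φ_n, P φ_n⟩`; as `α < k_1`, the factor `1 - α²/k_n²` is positive
  -- and the value at `n = 0` is positive as well.
  have hsgn : ((C n ^ 2 * overlap a α n : ℝ) : ℂ) = (-1) ^ n := by
    rw [hC, choiceSq_eq ha α]
    by_cases hn : n = 0
    · subst hn
      have := overlap_zero_pos ha hα hα'
      rw [abs_of_pos this, inv_mul_cancel₀ this.ne']
      simp
    · have := one_sub_pos ha hα hα' hn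
      simp only [overlap, if_neg hn]
      rw [abs_mul, abs_pow, abs_neg, abs_one, one_pow, one_mul, abs_of_pos this]
      push_cast
      have h1 : (1 - (α : ℂ) ^ 2 / kn a n ^ 2) ≠ 0 := by exact_mod_cast this.ne'
      rw [mul_comm, mul_assoc, mul_inv_cancel₀ h1, mul_one]
  rw [hsgn]
  refine Lp.ext ?_
  filter_upwards [Lp.coeFn_smul ((-1 : ℂ) ^ n) (phi a α n), phi_ae a α n,
    Lp.coeFn_add (parity a (phi a α n)) (K (parity a (phi a α n))),
    parity_ae_of_ae (phi_ae a α n), hK.2 (parity a (phi a α n)),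
    ae_restrict_mem measurableSet_Ioo] with x h1 h2 h3 h4 h5 hx
  have h6 : ∫ y, kernelK a α x y * parity a (phi a α n) y ∂(vol a) =
      ∫ y, kernelK a α x y * phiFun a α n (-y) ∂(vol a) := by
    refine integral_congr_ae ?_
    filter_upwards [parity_ae_of_ae (phi_ae a α n)] with y hy
    rw [hy]
  rw [h1, Pi.smul_apply, h2, h3, Pi.add_apply, h4, h5, h6, smul_eq_mul]
  by_cases hn : n = 0
  · subst hn
    rw [integral_kernelK_zero ha hα hα' hx]
    ring
  · rw [integral_kernelK_of_ne_zero ha α hn hx]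
    ring

end Kernel

end RobinPT

end

theorem mainTheorem6 (a α : ℝ) (ha : 0 < a) (hα : 0 < α) (hα' : α < Real.pi / (2 * a)) :
    -- the `φ_n` are eigenvectors of the adjoint of the (densely defined) operator `H`
    (Dense ((robin a (Complex.I * α) (Complex.I * α)).domain : Set (L2 a)) ∧
      ∀ n, phi a α n ≠ 0 ∧ (phi a α n, (eigenvalue a α n : ℂ) • phi a α n) ∈
        (robin a (Complex.I * α) (Complex.I * α)).adjoint.graph) ∧
    -- there is an admissible sequence with the prescribed squares
    (∃ C : ℕ → ℝ, IsAdmissible C ∧ ∀ n, C n ^ 2 = choiceSq a α n) ∧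
    -- for every admissible sequence, `Θ` exists, and `(P Θ)² = I` iff the squares are as prescribed;
    -- in that case the closed formulae hold
    ∀ C : ℕ → ℝ, IsAdmissible C → ∃ Θ : L2 a →L[ℂ] L2 a, IsTheta a α C Θ ∧
      ((parity a * Θ) ^ 2 = 1 ↔ ∀ n, C n ^ 2 = choiceSq a α n) ∧
      ((parity a * Θ) ^ 2 = 1 →
        IsMetricOperator (robin a (Complex.I * α) (Complex.I * α)) Θ ∧
        (∃ K : L2 a →L[ℂ] L2 a, IsIntegralOperator a (kernelK a α) K ∧ Θ = 1 + K) ∧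
        IsCOperator (parity a) (robin a (Complex.I * α) (Complex.I * α)) (parity a * Θ) ∧
        (∃ L : L2 a →L[ℂ] L2 a, IsIntegralOperator a (kernelL a α) L ∧
          parity a * Θ = parity a + L)) := by
  refine ⟨⟨dense_domain_robin ha hα hα', fun n => ⟨phi_ne_zero ha hα hα' n, ?_⟩⟩,
    exists_isAdmissible ha hα hα', fun C hC => ?_⟩
  · rw [adjoint_graph_robin ha hα hα']
    exact phi_mem_robinGraph ha α n
  · obtain ⟨Θ, hΘ⟩ := exists_isTheta ha hα hα' hC
    have hiff := hΘ.sq_eq_one_iff ha hα hα'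
    refine ⟨Θ, hΘ, hiff, fun hsq => ?_⟩
    obtain ⟨K, hK⟩ := exists_isIntegralOperator_kernelK a α
    have hΘK := hΘ.eq_one_add ha hα hα' (hiff.1 hsq) hK
    exact ⟨hΘ.isMetricOperator ha hα hα' hC hsq, ⟨K, hK, hΘK⟩,
      hΘ.isCOperator ha hα hα' hC hsq,
      ⟨parity a * K, hK.parity_mul, by rw [hΘK, mul_add, mul_one]⟩⟩
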